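/- Let $M$ be a four-dimensional smooth manifold with a smooth Lorentzian metric $g_{\mu\nu}$ of signature $(-+++)$ and a smooth covector field $Q_\mu$ (a Weyl space: the torsion-free connection $\nabla$ is determined by $\nabla_\alpha g_{\mu\nu}=-Q_\alpha g_{\mu\nu}$). Let $\phi$ be a smooth, nowhere vanishing function on $M$ and let $\omega,\beta,\lambda$ be real constants with $\beta\neq0$. Hats denote the Levi-Civita connection of $g$ and its curvature; $Q_{\mu\nu}=\partial_\mu Q_\nu-\partial_\nu Q_\mu$, $Q^2=Q_{\mu\nu}Q^{\mu\nu}$, $(\partial\phi)^2=g^{\mu\nu}\partial_\mu\phi\,\partial_\nu\phi$, round brackets around indices denote symmetrization with weight $\tfrac12$, and $$\mathcal E_{\mu\nu}=\hat G_{\mu\nu}-\frac1{\phi^2}\left(\hat\nabla_\mu\hat\nabla_\nu-g_{\mu\nu}\hat\nabla^2\right)\phi^2+\frac{\omega}{\phi^2}\left[\partial_\mu\phi\,\partial_\nu\phi-\tfrac12g_{\mu\nu}(\partial\phi)^2\right]+\frac{\omega-6}{4}\left(Q_\mu Q_\nu-\tfrac12g_{\mu\nu}Q_\kappa Q^\kappa\right)$$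 $$\qquad-\frac{\omega-6}{2\phi^2}\left[\partial_{(\mu}\phi^2\,Q_{\nu)}-\tfrac12g_{\mu\nu}\,\partial_\kappa\phi^2\,Q^\kappa\right]-\frac{\beta^2}{\phi^2}\left(Q_\mu{}^{\kappa}Q_{\nu\kappa}-\tfrac14g_{\mu\nu}Q^2\right).$$ Suppose that the following field equations, those of the gauge-invariant action $$S_g=\tfrac12\int d^4x\sqrt{-g}\left[\phi^2\hat R+\omega(\partial\phi)^2+\tfrac{\omega-6}{4}\phi^2Q_\mu Q^\mu+\tfrac{\omega-6}{2}\phi^2\hat\nabla_\mu Q^\mu-\tfrac{\beta^2}{2}Q^2-\tfrac{\lambda}{4}\phi^4\right]$$ for $Q_\mu$ and for $\phi$ (they are not modified by minimally coupled matter), hold on $M$: $$\hat\nabla^\mu Q_{\mu\nu}=\frac{6-\omega}{4\beta^2}\left(\phi^2Q_\nu-\partial_\nu\phi^2\right),$$ $$\hat R+\omega\frac{(\partial\phi)^2}{\phi^2}-\frac{\omega}{2}\frac{\hat\nabla^2\phi^2}{\phi^2}+\frac{\omega-6}{4}Q_\mu Q^\mu+\frac{\omega-6}{2}\hat\nabla_\mu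 Q^\mu-\frac{\lambda}{2}\phi^2=0.$$ Then $$\hat\nabla^\mu\left(\phi^2\mathcal E_{\mu\nu}+\frac{\lambda}{8}\phi^4g_{\mu\nu}\right)=0.$$ If moreover the metric field equation $$\mathcal E_{\mu\nu}=\frac1{\phi^2}T^{(m)}_{\mu\nu}-\frac{\lambda}{8}\phi^2g_{\mu\nu}$$ holds with a matter stress-energy tensor $T^{(m)}_{\mu\nu}$ (an arbitrary covariant tensor field of rank 2; no specific matter Lagrangian is assumed), then: (i) $T^{(m)}=g^{\mu\nu}T^{(m)}_{\mu\nu}=0$. (ii) $\hat\nabla^\mu T^{(m)}_{\mu\nu}=0$, and the matter moves along null geodesics of the Levi-Civita connection in the following sense: if on an open set $W\subseteq M$ the matter is a coherent stream, $T^{(m)}_{\mu\nu}=\rho\,k_\mu k_\nu$ with a smooth function $\rho$ and a smooth vector field $k$, then every integral curve of $k$ (on an open interval) that runs in the part of $W$ where $T^{(m)}\neq0$ is, up to an orientation-preserving change of parameter, an affinely parametrized null geodesic of $g$. -/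

import Mathlib

open scoped Manifold ContDiff

/-- The model space `ℝ⁴`. -/
abbrev E4 : Type := EuclideanSpace ℝ (Fin 4)

noncomputable section

/-! ### Tensor calculus in a coordinate chart

Components of tensor fields are functions of the coordinates `x : E4`.  The metric is a matrix
valued function `g`, a covector field is `w : E4 → Fin 4 → ℝ`, a covariant 2-tensor field is
`S : E4 → Matrix (Fin 4) (Fin 4) ℝ`.  All connections and curvatures below are those of the
Levi-Civita connection of `g`. -/

namespace Coord

/-- The partial derivative `∂_μ f`. -/
def pd (μ : Fin 4) (f : E4 → ℝ) (x : E4) : ℝ :=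
  fderiv ℝ f x (EuclideanSpace.single μ 1)

/-- The inverse metric `g^{μν}`. -/
def inv (g : E4 → Matrix (Fin 4) (Fin 4) ℝ) (x : E4) (μ ν : Fin 4) : ℝ :=
  (g x)⁻¹ μ ν

/-- The Christoffel symbols `{^α_{μν}}`. -/
def christoffel (g : E4 → Matrix (Fin 4) (Fin 4) ℝ) (α μ ν : Fin 4) (x : E4) : ℝ :=
  (1 / 2) * ∑ l, inv g x α l *
    (pd ν (fun y => g y μ l) x + pd μ (fun y => g y ν l) x - pd l (fun y => g y μ ν) x)

/-- The curvature tensor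
`R^α_{σμν} = ∂_μ Γ^α_{νσ} - ∂_ν Γ^α_{μσ} + Γ^α_{μκ} Γ^κ_{νσ} - Γ^α_{νκ} Γ^κ_{μσ}`. -/
def riemann (g : E4 → Matrix (Fin 4) (Fin 4) ℝ) (α σ μ ν : Fin 4) (x : E4) : ℝ :=
  pd μ (christoffel g α ν σ) x - pd ν (christoffel g α μ σ) x
    + ∑ κ, (christoffel g α μ κ x * christoffel g κ ν σ x
      - christoffel g α ν κ x * christoffel g κ μ σ x)

/-- The Ricci tensor `R_{μν} = R^κ_{μκν}`. -/
def ricci (g : E4 → Matrix (Fin 4) (Fin 4) ℝ) (μ ν : Fin 4) (x : E4) : ℝ :=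
  ∑ κ, riemann g κ μ κ ν x

/-- The trace `g^{μν} S_{μν}` of a covariant 2-tensor. -/
def trace (g S : E4 → Matrix (Fin 4) (Fin 4) ℝ) (x : E4) : ℝ :=
  ∑ μ, ∑ ν, inv g x μ ν * S x μ ν

/-- The curvature scalar `R = g^{μν} R_{μν}`. -/
def scalarCurv (g : E4 → Matrix (Fin 4) (Fin 4) ℝ) (x : E4) : ℝ :=
  ∑ μ, ∑ ν, inv g x μ ν * ricci g μ ν x

/-- The Einstein tensor `G_{μν} = R_{μν} - ½ g_{μν} R`. -/
def einstein (g : E4 → Matrix (Fin 4) (Fin 4) ℝ) (μ ν : Fin 4) (x : E4) : ℝ :=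
  ricci g μ ν x - (1 / 2) * g x μ ν * scalarCurv g x

/-- The scalar product `u_μ w^μ` of two covectors. -/
def dot (g : E4 → Matrix (Fin 4) (Fin 4) ℝ) (u w : E4 → Fin 4 → ℝ) (x : E4) : ℝ :=
  ∑ μ, ∑ ν, inv g x μ ν * u x μ * w x ν

/-- The differential `∂_μ f` as a covector field. -/
def grad (f : E4 → ℝ) (x : E4) (μ : Fin 4) : ℝ := pd μ f x

/-- The covariant derivative of a covector field, `∇_μ w_ν`. -/
def nabla1 (g : E4 → Matrix (Fin 4) (Fin 4) ℝ) (w : E4 → Fin 4 → ℝ) (μ ν : Fin 4) (x : E4) : ℝ :=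
  pd μ (fun y => w y ν) x - ∑ κ, christoffel g κ μ ν x * w x κ

/-- The covariant derivative of a covariant 2-tensor field, `∇_α S_{μν}`. -/
def nabla2 (g S : E4 → Matrix (Fin 4) (Fin 4) ℝ) (α μ ν : Fin 4) (x : E4) : ℝ :=
  pd α (fun y => S y μ ν) x
    - ∑ κ, (christoffel g κ α μ x * S x κ ν + christoffel g κ α ν x * S x μ κ)

/-- The divergence `∇_μ w^μ = g^{μν} ∇_μ w_ν` of a covector field. -/
def div1 (g : E4 → Matrix (Fin 4) (Fin 4) ℝ) (w : E4 → Fin 4 → ℝ) (x : E4) : ℝ :=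
  ∑ μ, ∑ ν, inv g x μ ν * nabla1 g w μ ν x

/-- The divergence `∇^μ S_{μν}` of a covariant 2-tensor field. -/
def div2 (g S : E4 → Matrix (Fin 4) (Fin 4) ℝ) (ν : Fin 4) (x : E4) : ℝ :=
  ∑ α, ∑ μ, inv g x α μ * nabla2 g S α μ ν x

/-- The second covariant derivative `∇_μ ∇_ν f` of a function. -/
def hess (g : E4 → Matrix (Fin 4) (Fin 4) ℝ) (f : E4 → ℝ) (μ ν : Fin 4) (x : E4) : ℝ :=
  nabla1 g (grad f) μ ν x

/-- The d'Alembertian `∇² f`. -/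
def box (g : E4 → Matrix (Fin 4) (Fin 4) ℝ) (f : E4 → ℝ) (x : E4) : ℝ :=
  div1 g (grad f) x

/-- The nonmetricity field strength `Q_{μν} = ∂_μ Q_ν - ∂_ν Q_μ`. -/
def fieldStrength (Q : E4 → Fin 4 → ℝ) (x : E4) : Matrix (Fin 4) (Fin 4) ℝ :=
  Matrix.of fun μ ν => pd μ (fun y => Q y ν) x - pd ν (fun y => Q y μ) x

/-- `Q_μ^κ Q_{νκ}`. -/
def strengthSq (g : E4 → Matrix (Fin 4) (Fin 4) ℝ) (Q : E4 → Fin 4 → ℝ) (μ ν : Fin 4)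
    (x : E4) : ℝ :=
  ∑ κ, ∑ l, inv g x κ l * fieldStrength Q x μ κ * fieldStrength Q x ν l

/-- `Q² = Q_{μν} Q^{μν}`. -/
def strengthNorm (g : E4 → Matrix (Fin 4) (Fin 4) ℝ) (Q : E4 → Fin 4 → ℝ) (x : E4) : ℝ :=
  ∑ μ, ∑ ν, inv g x μ ν * strengthSq g Q μ ν x

/-- The tensor `𝓔_{μν}`: the variation of the gravitational action with respect to the metric,
divided by `φ²`, with the term of the quartic potential left out. -/
def calE (om β : ℝ) (g : E4 → Matrix (Fin 4) (Fin 4) ℝ) (Q : E4 → Fin 4 → ℝ) (φ : E4 → ℝ)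
    (x : E4) : Matrix (Fin 4) (Fin 4) ℝ :=
  Matrix.of fun μ ν =>
    einstein g μ ν x
    - 1 / φ x ^ 2 * (hess g (fun y => φ y ^ 2) μ ν x - g x μ ν * box g (fun y => φ y ^ 2) x)
    + om / φ x ^ 2 * (pd μ φ x * pd ν φ x - (1 / 2) * g x μ ν * dot g (grad φ) (grad φ) x)
    + (om - 6) / 4 * (Q x μ * Q x ν - (1 / 2) * g x μ ν * dot g Q Q x)
    - (om - 6) / (2 * φ x ^ 2) *
        ((1 / 2) * (pd μ (fun y => φ y ^ 2) x * Q x ν + pd ν (fun y => φ y ^ 2) x * Q x μ)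
          - (1 / 2) * g x μ ν * dot g (grad fun y => φ y ^ 2) Q x)
    - β ^ 2 / φ x ^ 2 * (strengthSq g Q μ ν x - (1 / 4) * g x μ ν * strengthNorm g Q x)

/-- The inhomogeneous Proca equation (variation with respect to `Q_μ`) at `x`:
`∇^μ Q_{μν} = (6 - om) / (4 β²) (φ² Q_ν - ∂_ν φ²)`. -/
def ProcaAt (om β : ℝ) (g : E4 → Matrix (Fin 4) (Fin 4) ℝ) (Q : E4 → Fin 4 → ℝ) (φ : E4 → ℝ)
    (x : E4) : Prop :=
  ∀ ν, div2 g (fieldStrength Q) ν x =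
    (6 - om) / (4 * β ^ 2) * (φ x ^ 2 * Q x ν - pd ν (fun y => φ y ^ 2) x)

/-- The field equation of `φ` (variation with respect to `φ`) at `x`. -/
def ScalarAt (om lam : ℝ) (g : E4 → Matrix (Fin 4) (Fin 4) ℝ) (Q : E4 → Fin 4 → ℝ) (φ : E4 → ℝ)
    (x : E4) : Prop :=
  scalarCurv g x + om * (dot g (grad φ) (grad φ) x / φ x ^ 2)
    - om / 2 * (box g (fun y => φ y ^ 2) x / φ x ^ 2)
    + (om - 6) / 4 * dot g Q Q x + (om - 6) / 2 * div1 g Q x - lam / 2 * φ x ^ 2 = 0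

/-- The Einstein equation with matter (variation with respect to the metric) at `x`:
`𝓔_{μν} = T_{μν} / φ² - (λ / 8) φ² g_{μν}`. -/
def EinsteinAt (om β lam : ℝ) (g : E4 → Matrix (Fin 4) (Fin 4) ℝ) (Q : E4 → Fin 4 → ℝ)
    (φ : E4 → ℝ) (T : E4 → Matrix (Fin 4) (Fin 4) ℝ) (x : E4) : Prop :=
  ∀ μ ν, calE om β g Q φ x μ ν = 1 / φ x ^ 2 * T x μ ν - lam / 8 * φ x ^ 2 * g x μ ν

/-- The tensor `φ² 𝓔_{μν} + (λ / 8) φ⁴ g_{μν}`. -/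
def calETotal (om β lam : ℝ) (g : E4 → Matrix (Fin 4) (Fin 4) ℝ) (Q : E4 → Fin 4 → ℝ)
    (φ : E4 → ℝ) (x : E4) : Matrix (Fin 4) (Fin 4) ℝ :=
  φ x ^ 2 • calE om β g Q φ x + (lam / 8 * φ x ^ 4) • g x

end Coord

/-! ### Tensor fields on a four-dimensional manifold -/

section Manifold

variable (M : Type*) [TopologicalSpace M] [ChartedSpace E4 M]

/-- Covector fields on `M`. -/
abbrev CovectorField : Type _ := ∀ p : M, TangentSpace (𝓡 4) p →L[ℝ] ℝ

/-- Covariant 2-tensor fields on `M`. -/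
abbrev BilinField : Type _ :=
  ∀ p : M, TangentSpace (𝓡 4) p →L[ℝ] TangentSpace (𝓡 4) p →L[ℝ] ℝ

/-- Vector fields on `M`. -/
abbrev VecField : Type _ := ∀ p : M, TangentSpace (𝓡 4) p

variable {M}

/-- The coordinate vector `∂_μ` of the chart `e` at the point with coordinates `x`. -/
def coordVec (e : OpenPartialHomeomorph M E4) (μ : Fin 4) (x : E4) :
    TangentSpace (𝓡 4) (e.symm x) :=
  mfderiv (𝓡 4) (𝓡 4) e.symm x (EuclideanSpace.single μ (1 : ℝ) : E4)

/-- The components `w_μ = w(∂_μ)` of a covector field in the chart `e`. -/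
def covComp (e : OpenPartialHomeomorph M E4) (w : CovectorField M) (x : E4) (μ : Fin 4) : ℝ :=
  w (e.symm x) (coordVec e μ x)

/-- The components `S_{μν} = S(∂_μ, ∂_ν)` of a covariant 2-tensor field in the chart `e`. -/
def bilinComp (e : OpenPartialHomeomorph M E4) (S : BilinField M) (x : E4) :
    Matrix (Fin 4) (Fin 4) ℝ :=
  Matrix.of fun μ ν => S (e.symm x) (coordVec e μ x) (coordVec e ν x)

/-- The components `k^μ = dx^μ(k)` of a vector field in the chart `e`. -/
def vecComp (e : OpenPartialHomeomorph M E4) (k : VecField M) (x : E4) : E4 :=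
  mfderiv (𝓡 4) (𝓡 4) e (e.symm x) (k (e.symm x))

/-- The coordinate representation of a function in the chart `e`. -/
def funComp (e : OpenPartialHomeomorph M E4) (f : M → ℝ) (x : E4) : ℝ := f (e.symm x)

variable (M) in
/-- A four-dimensional Weyl space: a smooth Lorentzian metric `g` of signature `(-+++)` and a smooth
covector field `Q`, the Weyl gauge vector.  They determine the torsion-free connection `∇` of the
space, which is characterized by `∇_α g_{μν} = - Q_α g_{μν}`. -/
structure WeylSpace where
  /-- the metric -/
  g : BilinField M
  /-- the Weyl gauge vector -/
  Q : CovectorField M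
  /-- every tangent space has an orthonormal basis, with one timelike and three spacelike vectors
  (this contains the symmetry and the nondegeneracy of the metric) -/
  lorentzian : ∀ p : M, ∃ b : Module.Basis (Fin 4) ℝ (TangentSpace (𝓡 4) p), ∀ i j,
    g p (b i) (b j) = if i = j then (if i = 0 then -1 else 1) else 0
  /-- the metric is smooth -/
  smooth_g : ∀ e ∈ IsManifold.maximalAtlas (𝓡 4) ∞ M, ∀ μ ν,
    ContDiffOn ℝ ∞ (fun x => bilinComp e g x μ ν) e.target
  /-- the Weyl gauge vector is smooth -/
  smooth_Q : ∀ e ∈ IsManifold.maximalAtlas (𝓡 4) ∞ M, ∀ μ,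
    ContDiffOn ℝ ∞ (fun x => covComp e Q x μ) e.target

namespace WeylSpace

variable (S : WeylSpace M)

/-- The Proca equation holds on `M`, that is, in all charts. -/
def Proca (om β : ℝ) (φ : M → ℝ) : Prop :=
  ∀ e ∈ IsManifold.maximalAtlas (𝓡 4) ∞ M, ∀ x ∈ e.target,
    Coord.ProcaAt om β (bilinComp e S.g) (covComp e S.Q) (funComp e φ) x

/-- The field equation of `φ` holds on `M`. -/
def ScalarEq (om lam : ℝ) (φ : M → ℝ) : Prop :=
  ∀ e ∈ IsManifold.maximalAtlas (𝓡 4) ∞ M, ∀ x ∈ e.target,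
    Coord.ScalarAt om lam (bilinComp e S.g) (covComp e S.Q) (funComp e φ) x

/-- The Einstein equation with matter stress-energy tensor `T` holds on `M`. -/
def EinsteinEq (om β lam : ℝ) (φ : M → ℝ) (T : BilinField M) : Prop :=
  ∀ e ∈ IsManifold.maximalAtlas (𝓡 4) ∞ M, ∀ x ∈ e.target,
    Coord.EinsteinAt om β lam (bilinComp e S.g) (covComp e S.Q) (funComp e φ) (bilinComp e T) x

/-- `g^{μν} T_{μν} = 0` on `M`. -/
def Traceless (T : BilinField M) : Prop :=
  ∀ e ∈ IsManifold.maximalAtlas (𝓡 4) ∞ M, ∀ x ∈ e.target,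
    Coord.trace (bilinComp e S.g) (bilinComp e T) x = 0

/-- `∇̂^μ T_{μν} = 0` on `M`, for the Levi-Civita connection. -/
def Conserved (T : BilinField M) : Prop :=
  ∀ e ∈ IsManifold.maximalAtlas (𝓡 4) ∞ M, ∀ x ∈ e.target, ∀ ν,
    Coord.div2 (bilinComp e S.g) (bilinComp e T) ν x = 0

/-- `∇̂^μ (φ² 𝓔_{μν} + (λ / 8) φ⁴ g_{μν}) = 0` on `M`. -/
def DivergenceIdentity (om β lam : ℝ) (φ : M → ℝ) : Prop :=
  ∀ e ∈ IsManifold.maximalAtlas (𝓡 4) ∞ M, ∀ x ∈ e.target, ∀ ν,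
    Coord.div2 (bilinComp e S.g)
      (Coord.calETotal om β lam (bilinComp e S.g) (covComp e S.Q) (funComp e φ)) ν x = 0

/-- In the open set `W` the matter is a coherent stream: its stress-energy tensor has the form
`T_{μν} = ρ k_μ k_ν` with a smooth function `ρ` and a smooth vector field `k` (no causal character
of `k` is prescribed). -/
structure IsStream (T : BilinField M) (W : Set M) (ρ : M → ℝ) (k : VecField M) : Prop where
  isOpen : IsOpen W
  smooth_rho : ContMDiffOn (𝓡 4) 𝓘(ℝ) ∞ ρ W
  smooth_k : ∀ e ∈ IsManifold.maximalAtlas (𝓡 4) ∞ M,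
    ContDiffOn ℝ ∞ (vecComp e k) (e.target ∩ e.symm ⁻¹' W)
  eq : ∀ p ∈ W, ∀ u v : TangentSpace (𝓡 4) p,
    T p u v = ρ p * S.g p (k p) u * S.g p (k p) v

/-- On the open interval `J` the curve `c` is an (affinely parametrized) null geodesic of the
Levi-Civita connection: it is of class `C²`, its velocity is null and nonzero, and
`c''^α + {^α_{μν}} c'^μ c'^ν = 0` in all charts. -/
structure IsNullGeodesicOn (c : ℝ → M) (J : Set ℝ) : Prop where
  contMDiffOn : ContMDiffOn 𝓘(ℝ) (𝓡 4) 2 c J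
  velocity_ne_zero : ∀ e ∈ IsManifold.maximalAtlas (𝓡 4) ∞ M, ∀ t ∈ J, c t ∈ e.source →
    deriv (fun s => e (c s)) t ≠ 0
  null : ∀ e ∈ IsManifold.maximalAtlas (𝓡 4) ∞ M, ∀ t ∈ J, c t ∈ e.source →
    ∑ μ, ∑ ν, bilinComp e S.g (e (c t)) μ ν *
      deriv (fun s => e (c s)) t μ * deriv (fun s => e (c s)) t ν = 0
  geodesic : ∀ e ∈ IsManifold.maximalAtlas (𝓡 4) ∞ M, ∀ t ∈ J, c t ∈ e.source → ∀ α,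
    deriv (deriv fun s => e (c s)) t α +
      ∑ μ, ∑ ν, Coord.christoffel (bilinComp e S.g) α μ ν (e (c t)) *
        deriv (fun s => e (c s)) t μ * deriv (fun s => e (c s)) t ν = 0

/-- The curve `c` on the open interval `I` is a null geodesic up to an orientation preserving
change of parameter `σ : J → I`. -/
def IsNullGeodesicUpToParam (c : ℝ → M) (I : Set ℝ) : Prop :=
  ∃ (J : Set ℝ) (σ : ℝ → ℝ), IsOpen J ∧ J.OrdConnected ∧ Set.BijOn σ J I ∧
    ContDiffOn ℝ 2 σ J ∧ (∀ s ∈ J, 0 < deriv σ s) ∧ S.IsNullGeodesicOn (c ∘ σ) J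

/-- Wherever the matter with stress-energy tensor `T` is a coherent stream, its streamlines (the
integral curves of `k` through points where matter is present, `T ≠ 0`) are null geodesics. -/
def MovesOnNullGeodesics (T : BilinField M) : Prop :=
  ∀ (W : Set M) (ρ : M → ℝ) (k : VecField M), S.IsStream T W ρ k →
    ∀ (I : Set ℝ) (c : ℝ → M), IsOpen I → I.OrdConnected → IsMIntegralCurveOn (I := 𝓡 4) c k I →
      (∀ t ∈ I, c t ∈ W ∧ T (c t) ≠ 0) → S.IsNullGeodesicUpToParam c I

end WeylSpace

end Manifold

end

open scoped Manifold ContDiff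
noncomputable section

/-! ### Levi-Civita connection over a ring with derivations; curvature and Bianchi identities. -/

section

/-! Write `E` for the tensor φ²𝓔 + (λ/8)φ⁴g. Its conservation and its tracelessness are the Noether
identities of diffeomorphism and gauge invariance, taken on solutions of the equations for Q and φ.
No variational calculus is used: both are checked directly.

The double divergence of a skew tensor vanishes (`div1_div2`), so the divergence of the vector
equation is the constraint (6-ω)∇^ν(φ²Q_ν - ∂_νφ²) = 0 (`Proca.divergence`). In dimension four the
trace of `E` plus φ² times the scalar equation is (ω-6)/2 times the bracket of this constraint,
hence zero (`tr2_fieldTensor`). For the divergence of `E` (`mul_div2_fieldTensor`), the contracted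
Bianchi identity `d_tr2_ric` and the commutator formula `div2_hess` make the terms with the Ricci
tensor cancel; `div2_bl` and `div2_sq_curl` treat the terms quadratic in first derivatives and in Q.
What is left is the vector equation contracted with Q_{μν}, the constraint times Q_ν and the scalar
equation times ∂_νφ. The metric equation says T = `E`, so T is traceless and conserved.

For T = ρ k⊗k, tracelessness makes k null where ρ ≠ 0, and conservation reads ∇_k k = f k with f =
-ρ⁻¹∇·(ρk) (`stream`). A change of parameter with σ'' = -f σ'² removes the right-hand side
(`exists_affine_parameter`). This needs one function f along a curve that may cross many charts.
Since k is null, f is also given by ι_k dk♭ = f k♭, which is visibly independent of the chart; so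
only the naturality of the exterior derivative is needed, not the transformation law of the
Christoffel symbols.

The tensor identities are proved over a commutative ring with commuting derivations, where no
differentiability has to be discussed and matrices do the index bookkeeping. They are then applied
to the ring of smooth functions on an open set of ℝ⁴ and evaluated at points. -/

/-- A metric with its Levi-Civita connection over a commutative ring `R` of functions with commuting
derivations `d μ`: the matrix `A μ` has the entries `Γ^α_{μν}`. -/
structure LeviCivita (ι R : Type*) [Fintype ι] [DecidableEq ι] [CommRing R] [Algebra ℝ R] where
  d : ι → Derivation ℝ R R
  d_comm : ∀ i j f, d i (d j f) = d j (d i f)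
  g : Matrix ι ι R
  H : Matrix ι ι R
  A : ι → Matrix ι ι R
  g_symm : g.transpose = g
  g_mul_H : g * H = 1
  A_symm : ∀ μ ν α, A μ α ν = A ν α μ
  compat : ∀ α, g.map (d α) = (A α).transpose * g + g * A α

namespace LeviCivita

open Matrix Finset

variable {ι R : Type*} [Fintype ι] [DecidableEq ι] [CommRing R] [Algebra ℝ R]
  (L : LeviCivita ι R)

/-- The entrywise derivative of a matrix. -/
def D (α : ι) (X : Matrix ι ι R) : Matrix ι ι R := X.map (L.d α)

/-- The curvature, as a 2-form with values in the endomorphisms. -/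
def F (μ ν : ι) : Matrix ι ι R :=
  L.D μ (L.A ν) - L.D ν (L.A μ) + L.A μ * L.A ν - L.A ν * L.A μ

def ric : Matrix ι ι R := Matrix.of fun μ ν => ∑ κ, L.F κ ν κ μ

def tr2 (X : Matrix ι ι R) : R := ∑ μ, ∑ ν, L.H μ ν * X μ ν

def dot (u w : ι → R) : R := ∑ μ, ∑ ν, L.H μ ν * u μ * w ν

def grad (f : R) (μ : ι) : R := L.d μ f

def cov1 (w : ι → R) : Matrix ι ι R :=
  Matrix.of fun μ ν => L.d μ (w ν) - ∑ κ, L.A μ κ ν * w κ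

def cov2 (X : Matrix ι ι R) (α : ι) : Matrix ι ι R :=
  Matrix.of fun μ ν => L.d α (X μ ν) - ∑ κ, (L.A α κ μ * X κ ν + L.A α κ ν * X μ κ)

def div1 (w : ι → R) : R := ∑ μ, ∑ ν, L.H μ ν * L.cov1 w μ ν

def div2 (X : Matrix ι ι R) (ν : ι) : R := ∑ α, ∑ μ, L.H α μ * L.cov2 X α μ ν

/-- The exterior derivative of a covector field. -/
def curl (w : ι → R) : Matrix ι ι R := Matrix.of fun μ ν => L.d μ (w ν) - L.d ν (w μ)

/-- The contraction `u^μ X_{μν}`. -/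
def contr (u : ι → R) (X : Matrix ι ι R) (ν : ι) : R := ∑ α, ∑ μ, L.H α μ * u μ * X α ν

lemma D_apply (α : ι) (X : Matrix ι ι R) (μ ν : ι) : L.D α X μ ν = L.d α (X μ ν) := rfl

lemma D_mul (α : ι) (X Y : Matrix ι ι R) : L.D α (X * Y) = L.D α X * Y + X * L.D α Y := by
  ext μ ν
  simp only [D_apply, Matrix.mul_apply, Matrix.add_apply, map_sum, Derivation.leibniz,
    smul_eq_mul, ← Finset.sum_add_distrib]
  exact Finset.sum_congr rfl fun _ _ => by ring

lemma D_add (α : ι) (X Y : Matrix ι ι R) : L.D α (X + Y) = L.D α X + L.D α Y := by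
  ext; simp [D_apply]

lemma D_sub (α : ι) (X Y : Matrix ι ι R) : L.D α (X - Y) = L.D α X - L.D α Y := by
  ext; simp [D_apply]

lemma D_neg (α : ι) (X : Matrix ι ι R) : L.D α (-X) = -L.D α X := by
  ext; simp [D_apply]

lemma D_one (α : ι) : L.D α 1 = 0 := by
  ext i j
  rw [D_apply, Matrix.one_apply]
  split_ifs <;> simp

lemma D_transpose (α : ι) (X : Matrix ι ι R) : L.D α Xᵀ = (L.D α X)ᵀ := rfl

lemma D_comm (α β : ι) (X : Matrix ι ι R) : L.D α (L.D β X) = L.D β (L.D α X) := by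
  ext; simp [D_apply, L.d_comm α β]

lemma d_trace (α : ι) (X : Matrix ι ι R) : L.d α X.trace = (L.D α X).trace := by
  simp [Matrix.trace, D_apply]

lemma D_g (α : ι) : L.D α L.g = (L.A α)ᵀ * L.g + L.g * L.A α := L.compat α

lemma H_mul_g : L.H * L.g = 1 := mul_eq_one_comm.mp L.g_mul_H

lemma transpose_H : L.Hᵀ = L.H := by
  have h : L.Hᵀ * L.g = 1 := by
    have := congrArg transpose L.g_mul_H
    rwa [transpose_mul, L.g_symm, transpose_one] at this
  calc L.Hᵀ = L.Hᵀ * (L.g * L.H) := by rw [L.g_mul_H, mul_one]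
    _ = L.H := by rw [← mul_assoc, h, one_mul]

lemma H_symm (μ ν : ι) : L.H μ ν = L.H ν μ := congrFun (congrFun L.transpose_H ν) μ

lemma D_H (α : ι) : L.D α L.H = -(L.A α * L.H + L.H * (L.A α)ᵀ) := by
  have h := L.D_mul α L.g L.H
  rw [L.g_mul_H, D_one, D_g] at h
  calc L.D α L.H = L.H * (L.g * L.D α L.H) := by rw [← mul_assoc, H_mul_g, one_mul]
    _ = L.H * (-(((L.A α)ᵀ * L.g + L.g * L.A α) * L.H)) := by
        rw [eq_neg_of_add_eq_zero_right h.symm]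
    _ = -(L.H * L.g * L.A α * L.H + L.H * (L.A α)ᵀ * (L.g * L.H)) := by noncomm_ring
    _ = _ := by rw [H_mul_g, g_mul_H]; noncomm_ring

lemma cov2_eq (X : Matrix ι ι R) (α : ι) :
    L.cov2 X α = L.D α X - (L.A α)ᵀ * X - X * L.A α := by
  ext μ ν
  simp only [cov2, Matrix.of_apply, Matrix.sub_apply, Matrix.mul_apply, D_apply, transpose_apply,
    Finset.sum_add_distrib, sub_sub]
  congr 2
  exact Finset.sum_congr rfl fun _ _ => mul_comm _ _

lemma tr2_eq (X : Matrix ι ι R) : L.tr2 X = (L.H * Xᵀ).trace := by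
  simp [tr2, Matrix.trace, Matrix.mul_apply]

lemma d_tr2 (α : ι) (X : Matrix ι ι R) : L.d α (L.tr2 X) = L.tr2 (L.cov2 X α) := by
  have h : (L.A α * L.H * Xᵀ).trace = (L.H * Xᵀ * L.A α).trace := by
    rw [mul_assoc, trace_mul_comm]
  rw [tr2_eq, tr2_eq, d_trace, D_mul, D_H, cov2_eq, D_transpose]
  simp only [transpose_sub, transpose_mul, transpose_transpose, mul_sub, neg_mul, add_mul,
    trace_sub, trace_add, trace_neg, h, ← mul_assoc]
  abel

/-! ### Curvature -/

lemma F_neg (μ ν : ι) : L.F μ ν = -L.F ν μ := by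
  unfold F; abel

/-- Second derivatives of the inverse metric commute; expanded with `D_H`, this says that `F H` plus
its transpose vanishes. -/
lemma F_mul_H (μ ν : ι) : L.F μ ν * L.H = -(L.F μ ν * L.H)ᵀ := by
  have h := L.D_comm μ ν L.H
  simp only [D_H, D_neg, D_add, D_mul, D_transpose] at h
  rw [transpose_mul, transpose_H]
  simp only [F, transpose_add, transpose_sub, transpose_mul]
  have h2 := sub_eq_zero.mpr h
  rw [← sub_eq_zero, ← neg_eq_zero, ← h2]
  noncomm_ring

lemma F_mul_H_apply (μ ν α β : ι) : (L.F μ ν * L.H) α β = -(L.F μ ν * L.H) β α :=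
  congrFun (congrFun (L.F_mul_H μ ν) α) β

/-- Skewness carries the contraction over to the index pair that defines Ricci. Because of it,
neither the algebraic Bianchi identity nor the symmetry of `ric` is ever needed. -/
lemma sum_F_mul_H (α ν : ι) : ∑ μ, (L.F μ ν * L.H) α μ = -(L.H * L.ric) α ν := by
  have h : ∀ μ, (L.F μ ν * L.H) α μ = -∑ σ, L.F μ ν μ σ * L.H σ α := fun μ => by
    rw [F_mul_H_apply, Matrix.mul_apply]
  simp only [h, Finset.sum_neg_distrib, Matrix.mul_apply, ric, Matrix.of_apply, Finset.mul_sum]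
  rw [Finset.sum_comm]
  congr 1
  exact Finset.sum_congr rfl fun σ _ => Finset.sum_congr rfl fun μ _ => by
    rw [mul_comm, L.H_symm]

/-- The covariant derivative of the curvature with respect to the endomorphism indices. -/
def gaugeD (l μ ν : ι) : Matrix ι ι R :=
  L.D l (L.F μ ν) + L.A l * L.F μ ν - L.F μ ν * L.A l

/-- The Bianchi identity of an arbitrary matrix-valued connection form: derivatives commute and the
rest is a Jacobi identity. The symmetry of the Christoffel symbols plays no role yet. -/
lemma gaugeD_cyclic (l μ ν : ι) : L.gaugeD l μ ν + L.gaugeD μ ν l + L.gaugeD ν l μ = 0 := by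
  simp only [gaugeD, F, D_add, D_sub, D_mul]
  rw [L.D_comm μ l, L.D_comm ν l, L.D_comm ν μ]
  noncomm_ring

/-- The covariant derivative `∇_l R^·_{·μν}` of the curvature tensor. -/
def covF (l μ ν : ι) : Matrix ι ι R :=
  L.gaugeD l μ ν - ∑ κ, (L.A l κ μ • L.F κ ν + L.A l κ ν • L.F μ κ)

lemma covF_neg (l μ ν : ι) : L.covF l μ ν = -L.covF l ν μ := by
  have h : ∀ κ, L.A l κ μ • L.F κ ν + L.A l κ ν • L.F μ κ
      = -(L.A l κ ν • L.F κ μ + L.A l κ μ • L.F ν κ) := fun κ => by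
    rw [L.F_neg κ ν, L.F_neg μ κ, smul_neg, smul_neg]; abel
  simp only [covF, h, gaugeD, L.F_neg μ ν, D_neg, Finset.sum_neg_distrib]
  noncomm_ring

/-- Torsion-freeness makes the Christoffel terms of the form indices cancel in the cyclic sum, which
reduces the claim to `gaugeD_cyclic`. -/
lemma covF_cyclic (l μ ν : ι) : L.covF l μ ν + L.covF μ ν l + L.covF ν l μ = 0 := by
  have h : ∑ κ, (L.A l κ μ • L.F κ ν + L.A l κ ν • L.F μ κ)
      + ∑ κ, (L.A μ κ ν • L.F κ l + L.A μ κ l • L.F ν κ)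
      + ∑ κ, (L.A ν κ l • L.F κ μ + L.A ν κ μ • L.F l κ) = 0 := by
    rw [← Finset.sum_add_distrib, ← Finset.sum_add_distrib]
    refine Finset.sum_eq_zero fun κ _ => ?_
    rw [L.A_symm l μ, L.A_symm l ν, L.A_symm μ ν, L.F_neg κ l, L.F_neg κ ν, L.F_neg κ μ]
    simp only [smul_neg]
    abel
  have h2 := L.gaugeD_cyclic l μ ν
  rw [← sub_zero (0 : Matrix ι ι R)]
  nth_rewrite 1 [← h2]
  rw [← h]
  unfold covF
  abel

/-- Contraction of an upper with a lower index commutes with covariant differentiation, since the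
two Christoffel terms of the contracted pair cancel. -/
lemma sum_covF_eq_cov2_ric (l σ ν : ι) : ∑ α, L.covF l α ν α σ = L.cov2 L.ric l σ ν := by
  have h : ∑ α, (L.A l * L.F α ν) α σ = ∑ α, ∑ κ, L.A l κ α * L.F κ ν α σ := by
    simp only [Matrix.mul_apply]
    exact Finset.sum_comm
  have h2 : ∑ α, (L.F α ν * L.A l) α σ = ∑ κ, L.A l κ σ * L.ric κ ν := by
    simp only [Matrix.mul_apply, ric, Matrix.of_apply, Finset.mul_sum]
    rw [Finset.sum_comm]
    exact Finset.sum_congr rfl fun _ _ => Finset.sum_congr rfl fun _ _ => mul_comm _ _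
  have h3 : ∑ α, ∑ κ, L.A l κ ν * L.F α κ α σ = ∑ κ, L.A l κ ν * L.ric σ κ := by
    simp only [ric, Matrix.of_apply, Finset.mul_sum]
    exact Finset.sum_comm
  have h4 : ∑ α, L.D l (L.F α ν) α σ = L.d l (L.ric σ ν) := by
    simp [ric, D_apply]
  simp only [covF, gaugeD, cov2, Matrix.of_apply, Matrix.sub_apply, Matrix.add_apply,
    Matrix.sum_apply, Matrix.smul_apply, smul_eq_mul, Finset.sum_add_distrib,
    Finset.sum_sub_distrib, h, h2, h3, h4]
  ring

/-- The contraction of `sum_F_mul_H` survives covariant differentiation, because the inverse metric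
is parallel (`D_H`). -/
lemma sum_covF_mul_H (μ α l : ι) :
    ∑ ν, (L.covF μ ν l * L.H) α ν = -(L.H * L.cov2 L.ric μ) α l := by
  have hK : (Matrix.of fun α l => ∑ ν, (L.F ν l * L.H) α ν) = -(L.H * L.ric) := by
    ext α l; exact L.sum_F_mul_H α l
  set K : Matrix ι ι R := Matrix.of fun α l => ∑ ν, (L.F ν l * L.H) α ν with hKdef
  have h1 : (L.D μ K) α l = ∑ ν, (L.D μ (L.F ν l) * L.H - L.F ν l * L.A μ * L.H
      - L.F ν l * L.H * (L.A μ)ᵀ) α ν := by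
    rw [D_apply, hKdef, Matrix.of_apply, map_sum]
    refine Finset.sum_congr rfl fun ν _ => ?_
    rw [← D_apply, D_mul, D_H]
    refine congrFun (congrFun (?_ : (_ : Matrix ι ι R) = _) α) ν
    noncomm_ring
  have h2 : (L.A μ * K) α l = ∑ ν, (L.A μ * L.F ν l * L.H) α ν := by
    simp only [mul_assoc, Matrix.mul_apply (M := L.A μ), hKdef, Matrix.of_apply, Finset.mul_sum]
    exact Finset.sum_comm
  have h3 : (K * L.A μ) α l = ∑ ν, ∑ κ, L.A μ κ l * (L.F ν κ * L.H) α ν := by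
    rw [Matrix.mul_apply, Finset.sum_comm]
    refine Finset.sum_congr rfl fun κ _ => ?_
    rw [hKdef, Matrix.of_apply, Finset.sum_mul]
    exact Finset.sum_congr rfl fun _ _ => mul_comm _ _
  have h4 : ∑ ν, (L.F ν l * L.H * (L.A μ)ᵀ) α ν
      = ∑ ν, ∑ κ, L.A μ κ ν * (L.F κ l * L.H) α ν := by
    simp only [Matrix.mul_apply (N := (L.A μ)ᵀ), transpose_apply]
    refine Finset.sum_comm.trans ?_
    exact Finset.sum_congr rfl fun _ _ => Finset.sum_congr rfl fun _ _ => mul_comm _ _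
  have h5 : ∑ ν, (L.covF μ ν l * L.H) α ν = (L.D μ K + L.A μ * K - K * L.A μ) α l := by
    rw [Matrix.sub_apply, Matrix.add_apply, h1, h2, h3]
    simp only [covF, gaugeD, sub_mul, add_mul, Finset.sum_mul, smul_mul_assoc, Matrix.sub_apply,
      Matrix.add_apply, Matrix.sum_apply, Matrix.smul_apply, smul_eq_mul, Finset.sum_add_distrib,
      Finset.sum_sub_distrib, h4]
    ring
  rw [h5, hK, cov2_eq, ← Matrix.neg_apply]
  refine congrFun (congrFun (?_ : (_ : Matrix ι ι R) = _) α) l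
  rw [D_neg, D_mul, D_H]
  noncomm_ring

/-- The contracted Bianchi identity. -/
lemma d_tr2_ric (l : ι) : L.d l (L.tr2 L.ric) = 2 * L.div2 L.ric l := by
  -- The cyclic identity is contracted once here and once more with `H` in `h4`. The first term
  -- becomes the derivative of the scalar curvature, and each of the other two becomes minus the
  -- divergence of Ricci.
  have key : ∀ σ ν, ∑ α, (L.covF l α ν α σ + L.covF α ν l α σ + L.covF ν l α α σ) = 0 :=
    fun σ ν => Finset.sum_eq_zero fun α _ => by
      have := congrFun (congrFun (L.covF_cyclic l α ν) α) σ
      simpa only [Matrix.add_apply, Matrix.zero_apply] using this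
  have h1 : L.div2 L.ric l = ∑ σ, ∑ ν, L.H σ ν * L.cov2 L.ric ν σ l := by
    rw [div2, Finset.sum_comm]
    exact Finset.sum_congr rfl fun _ _ => Finset.sum_congr rfl fun _ _ => by rw [L.H_symm]
  have h2 : L.div2 L.ric l = -∑ σ, ∑ ν, L.H σ ν * ∑ α, L.covF α ν l α σ := by
    have h : ∀ α, ∑ μ, L.H α μ * L.cov2 L.ric α μ l = -∑ ν, ∑ σ, L.covF α ν l α σ * L.H σ ν :=
      fun α => by
        have := L.sum_covF_mul_H α α l
        rw [Matrix.mul_apply] at this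
        rw [← neg_eq_iff_eq_neg, ← this]
        simp only [Matrix.mul_apply]
    simp only [div2, h, Finset.sum_neg_distrib, Finset.mul_sum]
    congr 1
    rw [Finset.sum_comm_cycle]
    refine Finset.sum_congr rfl fun σ _ => ?_
    rw [Finset.sum_comm]
    exact Finset.sum_congr rfl fun _ _ => Finset.sum_congr rfl fun _ _ => mul_comm _ _
  have h3 : ∀ σ ν, L.cov2 L.ric l σ ν + ∑ α, L.covF α ν l α σ - L.cov2 L.ric ν σ l = 0 :=
    fun σ ν => by
      have h := key σ ν
      simp only [Finset.sum_add_distrib, L.covF_neg ν l, Matrix.neg_apply,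
        Finset.sum_neg_distrib, sum_covF_eq_cov2_ric] at h
      linear_combination h
  have h4 : ∑ σ, ∑ ν, L.H σ ν * (L.cov2 L.ric l σ ν + ∑ α, L.covF α ν l α σ
      - L.cov2 L.ric ν σ l) = 0 := by simp [h3]
  simp only [mul_add, mul_sub, Finset.sum_add_distrib, Finset.sum_sub_distrib] at h4
  rw [d_tr2, tr2, two_mul]
  nth_rewrite 1 [h1]
  rw [h2]
  linear_combination h4

end LeviCivita

end

/-! ### Covectors, divergences and product rules. -/

section

namespace LeviCivita

open Matrix Finset

variable {ι R : Type*} [Fintype ι] [DecidableEq ι] [CommRing R] [Algebra ℝ R]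
  (L : LeviCivita ι R)

lemma eq_zero_of_eq_neg {x : R} (h : x = -x) : x = 0 := by
  have h2 : x + x = 0 := by nth_rewrite 1 [h]; simp
  calc x = (1 / 2 : ℝ) • (x + x) := by rw [← two_smul ℝ x, smul_smul]; norm_num
    _ = 0 := by rw [h2, smul_zero]

omit [DecidableEq ι] in
lemma sum_antisymm {X : ι → ι → R} (h : ∀ μ ν, X μ ν = -X ν μ) : ∑ μ, ∑ ν, X μ ν = 0 := by
  refine eq_zero_of_eq_neg ?_
  nth_rewrite 1 [Finset.sum_comm]
  simp only [← Finset.sum_neg_distrib]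
  exact Finset.sum_congr rfl fun _ _ => Finset.sum_congr rfl fun _ _ => h _ _

/-! ### Covectors -/

lemma cov1_apply (w : ι → R) (μ ν : ι) :
    L.cov1 w μ ν = L.d μ (w ν) - ∑ κ, L.A μ κ ν * w κ := rfl

/-- The covariant derivative of a covector field in the direction `α`. -/
lemma cov1_eq (w : ι → R) (α : ι) : L.cov1 w α = (fun ν => L.d α (w ν)) - w ᵥ* L.A α := by
  ext ν
  simp only [cov1, Matrix.of_apply, Pi.sub_apply, Matrix.vecMul, dotProduct]
  congr 1
  exact Finset.sum_congr rfl fun _ _ => mul_comm _ _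

lemma d_vecMul (α : ι) (w : ι → R) (X : Matrix ι ι R) :
    (fun ν => L.d α ((w ᵥ* X) ν)) = (fun ν => L.d α (w ν)) ᵥ* X + w ᵥ* L.D α X := by
  ext ν
  simp only [Matrix.vecMul, dotProduct, Pi.add_apply, map_sum, Derivation.leibniz, smul_eq_mul,
    D_apply, ← Finset.sum_add_distrib]
  exact Finset.sum_congr rfl fun _ _ => by ring

/-- The indices `α` and `ν` are frozen labels of directions here, so the commutator is pure
curvature. Torsion-freeness is needed only in `cov2_cov1_comm`, where they become tensor indices. -/
lemma cov1_cov1 (w : ι → R) (α ν : ι) :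
    L.cov1 (L.cov1 w ν) α - L.cov1 (L.cov1 w α) ν = -(w ᵥ* L.F α ν) := by
  have h : ∀ α ν, L.cov1 (L.cov1 w ν) α = (fun μ => L.d α (L.d ν (w μ)))
      - ((fun μ => L.d α (w μ)) ᵥ* L.A ν + w ᵥ* L.D α (L.A ν))
      - ((fun μ => L.d ν (w μ)) ᵥ* L.A α - w ᵥ* (L.A ν * L.A α)) := fun α ν => by
    rw [L.cov1_eq _ α, ← d_vecMul, cov1_eq, sub_vecMul, vecMul_vecMul]
    congr 1
    ext μ
    simp
  have h2 : (fun μ => L.d α (L.d ν (w μ))) = (fun μ => L.d ν (L.d α (w μ))) :=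
    funext fun _ => L.d_comm _ _ _
  rw [h, h, h2, F]
  simp only [vecMul_sub, vecMul_add]
  abel

lemma cov2_cov1 (w : ι → R) (α ν μ : ι) :
    L.cov2 (L.cov1 w) α ν μ = L.cov1 (L.cov1 w ν) α μ - ∑ κ, L.A α κ ν * L.cov1 w κ μ := by
  simp only [cov2, Matrix.of_apply, L.cov1_apply (L.cov1 w ν), Finset.sum_add_distrib]
  ring

/-- The Ricci identity for covectors. -/
lemma cov2_cov1_comm (w : ι → R) (α ν μ : ι) :
    L.cov2 (L.cov1 w) α ν μ = L.cov2 (L.cov1 w) ν α μ - (w ᵥ* L.F α ν) μ := by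
  have h := congrFun (L.cov1_cov1 w α ν) μ
  simp only [Pi.sub_apply, Pi.neg_apply] at h
  simp only [cov2_cov1, L.A_symm α ν]
  linear_combination h

lemma cov2_transpose (X : Matrix ι ι R) (α : ι) : L.cov2 Xᵀ α = (L.cov2 X α)ᵀ := by
  simp only [cov2_eq, D_transpose, transpose_sub, transpose_mul, transpose_transpose]
  abel

lemma cov1_grad_symm (f : R) : (L.cov1 (L.grad f))ᵀ = L.cov1 (L.grad f) := by
  ext μ ν
  simp only [cov1, transpose_apply, Matrix.of_apply, grad, L.d_comm μ ν, L.A_symm μ ν]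

/-- The divergence of the Hessian of a function. -/
lemma div2_hess (f : R) (ν : ι) :
    L.div2 (L.cov1 (L.grad f)) ν
      = L.d ν (L.div1 (L.grad f)) + L.contr (L.grad f) L.ric ν := by
  set w := L.grad f with hw
  -- The symmetry of the Hessian first brings `ν` next to `α`; then the Ricci identity exchanges the
  -- two derivatives.
  have h1 : ∀ α μ, L.cov2 (L.cov1 w) α μ ν
      = L.cov2 (L.cov1 w) ν α μ - (w ᵥ* L.F α ν) μ := fun α μ => by
    rw [← cov2_cov1_comm, hw]
    conv_lhs => rw [← cov1_grad_symm, cov2_transpose, transpose_apply]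
  have h2 : ∑ α, ∑ μ, L.H α μ * (w ᵥ* L.F α ν) μ = -L.contr w L.ric ν := by
    have h3 : ∀ α, ∑ μ, L.H α μ * (w ᵥ* L.F α ν) μ = ∑ κ, w κ * (L.F α ν * L.H) κ α :=
      fun α => by
        simp only [Matrix.vecMul, dotProduct, Matrix.mul_apply, Finset.mul_sum]
        rw [Finset.sum_comm]
        exact Finset.sum_congr rfl fun _ _ => Finset.sum_congr rfl fun _ _ => by
          rw [L.H_symm α]; ring
    simp only [h3]
    rw [Finset.sum_comm]
    simp only [← Finset.mul_sum, sum_F_mul_H]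
    simp only [Matrix.mul_apply, mul_neg, Finset.sum_neg_distrib, contr]
    rw [Finset.sum_comm (γ := ι)]
    simp only [Finset.mul_sum]
    congr 1
    exact Finset.sum_congr rfl fun _ _ => Finset.sum_congr rfl fun _ _ => by
      rw [L.H_symm]; ring
  have h4 : L.d ν (L.div1 w) = ∑ α, ∑ μ, L.H α μ * L.cov2 (L.cov1 w) ν α μ :=
    L.d_tr2 ν (L.cov1 w)
  rw [h4, ← neg_neg (L.contr w L.ric ν), ← h2, div2]
  simp only [h1, mul_sub, Finset.sum_sub_distrib]
  ring

/-! ### Divergences in terms of the contracted Christoffel symbols -/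

/-- By skewness the curvature is minus a conjugate, by the metric, of its own transpose. -/
lemma trace_F (μ ν : ι) : (L.F μ ν).trace = 0 := by
  refine eq_zero_of_eq_neg ?_
  have h : L.F μ ν = -(L.H * (L.F μ ν)ᵀ * L.g) := by
    calc L.F μ ν = L.F μ ν * L.H * L.g := by rw [mul_assoc, H_mul_g, mul_one]
      _ = _ := by rw [F_mul_H, transpose_mul, transpose_H, neg_mul]
  conv_lhs => rw [h]
  rw [trace_neg, trace_mul_comm, ← mul_assoc, g_mul_H, one_mul, trace_transpose]

/-- The one-form Γ_μ = Γ^κ_{μκ} is closed. It stands in for the differential of log √|g|, so that no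
determinant has to be differentiated. -/
lemma d_trace_A (μ ν : ι) : L.d μ (L.A ν).trace = L.d ν (L.A μ).trace := by
  have h := L.trace_F μ ν
  rw [F, trace_sub, trace_add, trace_sub, trace_mul_comm (L.A μ), ← d_trace, ← d_trace] at h
  linear_combination h

lemma H_mulVec_cov1 (w : ι → R) (β : ι) : L.H *ᵥ L.cov1 w β
    = (fun κ => L.d β ((L.H *ᵥ w) κ)) + L.A β *ᵥ (L.H *ᵥ w) := by
  have h1 : (fun κ => L.d β ((L.H *ᵥ w) κ))
      = L.H *ᵥ (fun ν => L.d β (w ν)) + L.D β L.H *ᵥ w := by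
    ext κ
    simp only [Matrix.mulVec, dotProduct, Pi.add_apply, map_sum, Derivation.leibniz,
      smul_eq_mul, D_apply, ← Finset.sum_add_distrib]
    exact Finset.sum_congr rfl fun _ _ => by ring
  rw [h1, D_H, cov1_eq, mulVec_sub, neg_mulVec, add_mulVec, ← mulVec_transpose]
  simp only [mulVec_mulVec]
  abel

lemma div1_eq (w : ι → R) :
    L.div1 w = ∑ β, (L.d β ((L.H *ᵥ w) β) + (L.A β).trace * (L.H *ᵥ w) β) := by
  have h2 : ∀ β, ∑ ν, L.H β ν * L.cov1 w β ν
      = L.d β ((L.H *ᵥ w) β) + (L.A β *ᵥ (L.H *ᵥ w)) β :=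
    fun β => congrFun (L.H_mulVec_cov1 w β) β
  simp only [div1, h2, Finset.sum_add_distrib]
  congr 1
  simp only [Matrix.trace, Matrix.diag_apply, Finset.sum_mul]
  rw [Finset.sum_comm]
  refine Finset.sum_congr rfl fun β _ => ?_
  rw [Matrix.mulVec, dotProduct]
  exact Finset.sum_congr rfl fun κ _ => by rw [L.A_symm]

/-- The divergence of a skew tensor. -/
lemma H_mulVec_div2 {X : Matrix ι ι R} (hX : Xᵀ = -X) (κ : ι) :
    (L.H *ᵥ L.div2 X) κ = ∑ α, (L.d α ((L.H * X * L.H) α κ)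
      + (L.A α).trace * (L.H * X * L.H) α κ) := by
  set P := L.H * X * L.H with hP
  have hPt : Pᵀ = -P := by
    rw [hP, transpose_mul, transpose_mul, hX, transpose_H]
    simp [mul_assoc]
  have h1 : ∀ α, L.H * L.cov2 X α * L.H = L.D α P + L.A α * P + P * (L.A α)ᵀ := fun α => by
    rw [hP, D_mul, D_mul, D_H, cov2_eq]
    noncomm_ring
  have h2 : (L.H *ᵥ L.div2 X) κ = ∑ α, (L.H * L.cov2 X α * L.H) α κ := by
    have h : ∀ ν, L.div2 X ν = ∑ α, (L.H * L.cov2 X α) α ν := fun ν => by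
      simp only [div2, Matrix.mul_apply]
    simp only [Matrix.mulVec, dotProduct, h, Finset.mul_sum, Matrix.mul_apply (N := L.H)]
    rw [Finset.sum_comm]
    exact Finset.sum_congr rfl fun _ _ => Finset.sum_congr rfl fun _ _ => by
      rw [L.H_symm κ, mul_comm]
  -- Christoffel symbols, symmetric in the lower indices, are contracted with a skew tensor.
  have h3 : ∑ α, (P * (L.A α)ᵀ) α κ = 0 := by
    simp only [Matrix.mul_apply, transpose_apply]
    refine sum_antisymm fun α l => ?_
    rw [L.A_symm α l, ← neg_mul, ← Matrix.neg_apply, ← hPt, transpose_apply]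
  have h4 : ∑ α, (L.A α * P) α κ = ∑ α, (L.A α).trace * P α κ := by
    simp only [Matrix.mul_apply, Matrix.trace, Matrix.diag_apply, Finset.sum_mul]
    rw [Finset.sum_comm]
    exact Finset.sum_congr rfl fun _ _ => Finset.sum_congr rfl fun _ _ => by rw [L.A_symm]
  simp only [h2, h1, Matrix.add_apply, Finset.sum_add_distrib, h3, h4, D_apply, add_zero]

/-- With Γ_μ the trace of `A μ`, the double divergence is (∂_β + Γ_β)(∂_α + Γ_α) applied to the skew
P^{αβ}. The operators commute because Γ is closed, so the sum is antisymmetric. -/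
lemma div1_div2 {X : Matrix ι ι R} (hX : Xᵀ = -X) : L.div1 (L.div2 X) = 0 := by
  have hP : ∀ α β, (L.H * X * L.H) α β = -(L.H * X * L.H) β α := fun α β => by
    rw [← Matrix.transpose_apply (L.H * X * L.H), transpose_mul, transpose_mul, hX, transpose_H]
    simp [mul_assoc]
  rw [div1_eq]
  simp only [L.H_mulVec_div2 hX, map_sum, Finset.mul_sum, ← Finset.sum_add_distrib]
  refine sum_antisymm fun β α => ?_
  rw [hP α β]
  simp only [map_add, map_neg, Derivation.leibniz, smul_eq_mul]
  rw [L.d_trace_A β α, L.d_comm β α]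
  ring

/-! ### Product rules -/

def outer (u w : ι → R) : Matrix ι ι R := Matrix.of fun μ ν => u μ * w ν

/-- `u_μ w_ν + w_μ u_ν - g_{μν} u_κ w^κ`. -/
def bl (u w : ι → R) : Matrix ι ι R := outer u w + outer w u - L.dot u w • L.g

/-- `X_μ^κ X_{νκ}`. -/
def sq (X : Matrix ι ι R) : Matrix ι ι R :=
  Matrix.of fun μ ν => ∑ κ, ∑ l, L.H κ l * X μ κ * X ν l

lemma cov2_add (X Y : Matrix ι ι R) (α : ι) : L.cov2 (X + Y) α = L.cov2 X α + L.cov2 Y α := by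
  simp only [cov2_eq, D_add]
  noncomm_ring

lemma cov2_sub (X Y : Matrix ι ι R) (α : ι) : L.cov2 (X - Y) α = L.cov2 X α - L.cov2 Y α := by
  simp only [cov2_eq, D_sub]
  noncomm_ring

lemma cov2_smul (f : R) (X : Matrix ι ι R) (α : ι) :
    L.cov2 (f • X) α = L.d α f • X + f • L.cov2 X α := by
  have h : L.D α (f • X) = L.d α f • X + f • L.D α X := by
    ext; simp [D_apply]; ring
  simp only [cov2_eq, h, smul_sub, Matrix.mul_smul, Matrix.smul_mul]
  abel

lemma cov2_g (α : ι) : L.cov2 L.g α = 0 := by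
  rw [cov2_eq, D_g]; abel

lemma cov2_outer (u w : ι → R) (α μ ν : ι) :
    L.cov2 (outer u w) α μ ν = L.cov1 u α μ * w ν + u μ * L.cov1 w α ν := by
  have h1 : ∑ κ, L.A α κ μ * (u κ * w ν) = (∑ κ, L.A α κ μ * u κ) * w ν := by
    rw [Finset.sum_mul]; exact Finset.sum_congr rfl fun _ _ => by ring
  have h2 : ∑ κ, L.A α κ ν * (u μ * w κ) = u μ * ∑ κ, L.A α κ ν * w κ := by
    rw [Finset.mul_sum]; exact Finset.sum_congr rfl fun _ _ => by ring
  simp only [cov2, cov1, outer, Matrix.of_apply, Finset.sum_add_distrib, h1, h2,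
    Derivation.leibniz, smul_eq_mul]
  ring

lemma div2_add (X Y : Matrix ι ι R) (ν : ι) : L.div2 (X + Y) ν = L.div2 X ν + L.div2 Y ν := by
  simp only [div2, cov2_add, Matrix.add_apply, mul_add, Finset.sum_add_distrib]

lemma div2_sub (X Y : Matrix ι ι R) (ν : ι) : L.div2 (X - Y) ν = L.div2 X ν - L.div2 Y ν := by
  simp only [div2, cov2_sub, Matrix.sub_apply, mul_sub, Finset.sum_sub_distrib]

lemma div2_smul (f : R) (X : Matrix ι ι R) (ν : ι) :
    L.div2 (f • X) ν = L.contr (L.grad f) X ν + f * L.div2 X ν := by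
  simp only [div2, contr, grad, cov2_smul, Matrix.add_apply, Matrix.smul_apply, smul_eq_mul,
    mul_add, Finset.sum_add_distrib, Finset.mul_sum]
  congr 1
  · rw [Finset.sum_comm]
    exact Finset.sum_congr rfl fun _ _ => Finset.sum_congr rfl fun _ _ => by
      rw [L.H_symm]; ring
  · exact Finset.sum_congr rfl fun _ _ => Finset.sum_congr rfl fun _ _ => by ring

lemma contr_g (u : ι → R) (ν : ι) : L.contr u L.g ν = u ν := by
  have h : L.contr u L.g ν = (u ᵥ* (L.H * L.g)) ν := by
    simp only [contr, Matrix.vecMul, dotProduct, Matrix.mul_apply, Finset.mul_sum]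
    rw [Finset.sum_comm]
    exact Finset.sum_congr rfl fun _ _ => Finset.sum_congr rfl fun _ _ => by
      rw [L.H_symm]; ring
  rw [h, H_mul_g, vecMul_one]

lemma div2_smul_g (f : R) (ν : ι) : L.div2 (f • L.g) ν = L.d ν f := by
  rw [div2_smul, contr_g]
  simp [div2, cov2_g, grad]

lemma div2_const_smul {f : R} (hf : ∀ μ, L.d μ f = 0) (X : Matrix ι ι R) (ν : ι) :
    L.div2 (f • X) ν = f * L.div2 X ν := by
  rw [div2_smul]
  simp [contr, grad, hf]

lemma tr2_outer (u w : ι → R) : L.tr2 (outer u w) = L.dot u w := by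
  simp only [tr2, dot, outer, Matrix.of_apply, mul_assoc]

lemma tr2_add (X Y : Matrix ι ι R) : L.tr2 (X + Y) = L.tr2 X + L.tr2 Y := by
  simp only [tr2, Matrix.add_apply, mul_add, Finset.sum_add_distrib]

lemma tr2_sub (X Y : Matrix ι ι R) : L.tr2 (X - Y) = L.tr2 X - L.tr2 Y := by
  simp only [tr2, Matrix.sub_apply, mul_sub, Finset.sum_sub_distrib]

lemma tr2_smul (f : R) (X : Matrix ι ι R) : L.tr2 (f • X) = f * L.tr2 X := by
  simp only [tr2, Matrix.smul_apply, smul_eq_mul, Finset.mul_sum]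
  exact Finset.sum_congr rfl fun _ _ => Finset.sum_congr rfl fun _ _ => by ring

lemma tr2_g : L.tr2 L.g = Fintype.card ι := by
  rw [tr2_eq, L.g_symm, H_mul_g, trace_one]

lemma dot_comm (u w : ι → R) : L.dot u w = L.dot w u := by
  rw [dot, dot, Finset.sum_comm]
  exact Finset.sum_congr rfl fun _ _ => Finset.sum_congr rfl fun _ _ => by rw [L.H_symm]; ring

lemma d_dot (ν : ι) (u w : ι → R) : L.d ν (L.dot u w)
    = ∑ α, ∑ μ, L.H α μ * (w μ * L.cov1 u ν α + u μ * L.cov1 w ν α) := by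
  rw [← tr2_outer, d_tr2, tr2]
  simp only [cov2_outer, mul_add, Finset.sum_add_distrib]
  congr 1
  · exact Finset.sum_congr rfl fun _ _ => Finset.sum_congr rfl fun _ _ => by ring
  · rw [Finset.sum_comm]
    exact Finset.sum_congr rfl fun _ _ => Finset.sum_congr rfl fun _ _ => by rw [L.H_symm]

lemma div2_outer (u w : ι → R) (ν : ι) :
    L.div2 (outer u w) ν = L.div1 u * w ν + L.contr u (L.cov1 w) ν := by
  simp only [div2, cov2_outer, mul_add, Finset.sum_add_distrib, div1, contr, Finset.sum_mul,
    mul_assoc]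

lemma curl_eq (w : ι → R) (μ ν : ι) : L.curl w μ ν = L.cov1 w μ ν - L.cov1 w ν μ := by
  simp only [curl, cov1, Matrix.of_apply, L.A_symm μ ν]
  ring

lemma contr_curl (u w : ι → R) (ν : ι) : L.contr u (L.curl w) ν
    = L.contr u (L.cov1 w) ν - ∑ α, ∑ μ, L.H α μ * (u μ * L.cov1 w ν α) := by
  simp only [contr, curl_eq, mul_sub, Finset.sum_sub_distrib, mul_assoc]

/-- The derivative of `dot u w` turns the terms u^α∇_αw_ν and w^α∇_αu_ν into contractions with
exterior derivatives. When `u` is a gradient, one of these is zero. -/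
lemma div2_bl (u w : ι → R) (ν : ι) : L.div2 (L.bl u w) ν =
    L.div1 u * w ν + L.div1 w * u ν + L.contr u (L.curl w) ν + L.contr w (L.curl u) ν := by
  rw [bl, div2_sub, div2_add, div2_smul_g, div2_outer, div2_outer, d_dot, contr_curl, contr_curl]
  simp only [mul_add, Finset.sum_add_distrib]
  ring

lemma curl_grad (f : R) : L.curl (L.grad f) = 0 := by
  ext μ ν
  simp [curl, grad, L.d_comm μ ν]

lemma contr_zero (u : ι → R) (ν : ι) : L.contr u 0 ν = 0 := by simp [contr]

lemma sq_eq (X : Matrix ι ι R) : L.sq X = X * L.H * Xᵀ := by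
  ext μ ν
  simp only [sq, Matrix.of_apply, Matrix.mul_apply, Finset.sum_mul, transpose_apply]
  rw [Finset.sum_comm]
  exact Finset.sum_congr rfl fun _ _ => Finset.sum_congr rfl fun _ _ => by ring

/-- The identity ddw = 0; by torsion-freeness partial derivatives may be replaced by covariant ones.
-/
lemma cov2_curl_cyclic (w : ι → R) (α ν κ : ι) : L.cov2 (L.curl w) α ν κ
    + L.cov2 (L.curl w) ν κ α + L.cov2 (L.curl w) κ α ν = 0 := by
  have h : ∑ k, (L.A α k ν * L.curl w k κ + L.A α k κ * L.curl w ν k)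
      + ∑ k, (L.A ν k κ * L.curl w k α + L.A ν k α * L.curl w κ k)
      + ∑ k, (L.A κ k α * L.curl w k ν + L.A κ k ν * L.curl w α k) = 0 := by
    rw [← Finset.sum_add_distrib, ← Finset.sum_add_distrib]
    refine Finset.sum_eq_zero fun k _ => ?_
    simp only [curl, Matrix.of_apply]
    rw [L.A_symm α ν, L.A_symm α κ, L.A_symm ν κ]
    ring
  have h2 : L.d α (L.curl w ν κ) + L.d ν (L.curl w κ α) + L.d κ (L.curl w α ν) = 0 := by
    simp only [curl, Matrix.of_apply, map_sub]
    rw [L.d_comm α ν, L.d_comm α κ, L.d_comm ν κ]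
    ring
  simp only [cov2, Matrix.of_apply]
  linear_combination h2 - h

lemma curl_transpose (w : ι → R) : (L.curl w)ᵀ = -L.curl w := by
  ext μ ν
  simp [curl]

/-- The divergence of the stress-energy tensor of a field strength. -/
lemma div2_sq_curl (w : ι → R) (ν : ι) :
    4 * L.div2 (L.sq (L.curl w)) ν = L.d ν (L.tr2 (L.sq (L.curl w)))
      - 4 * L.contr (L.div2 (L.curl w)) (L.curl w) ν := by
  set X := L.curl w with hX
  set P := L.H * X * L.H with hP
  have hXt : Xᵀ = -X := L.curl_transpose w
  have hPt : Pᵀ = -P := by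
    rw [hP, transpose_mul, transpose_mul, hXt, transpose_H]
    simp [mul_assoc]
  have hP_symm : ∀ α κ, P α κ = -P κ α := fun α κ => by
    rw [← Matrix.neg_apply, ← hPt, transpose_apply]
  have hcov : ∀ α ν κ, L.cov2 X α ν κ = -L.cov2 X α κ ν := fun α ν κ => by
    have h := congrFun (congrFun (L.cov2_transpose X α) κ) ν
    have h2 : L.cov2 (-X) α = -L.cov2 X α := by
      simp only [cov2_eq, D_neg]
      noncomm_ring
    rw [hXt, h2, transpose_apply, Matrix.neg_apply] at h
    exact h.symm
  have hsq : ∀ α, L.cov2 (L.sq X) α = L.cov2 X α * L.H * Xᵀ + X * L.H * (L.cov2 X α)ᵀ :=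
    fun α => by
      simp only [sq_eq, cov2_eq, D_mul, D_H, D_transpose, transpose_sub, transpose_mul,
        transpose_transpose]
      noncomm_ring
  have h1 : L.div2 (L.sq X) ν
      = -L.contr (L.div2 X) X ν + ∑ α, ∑ κ, P α κ * L.cov2 X α ν κ := by
    have h5 : ∀ μ, L.div2 X μ = ∑ α, (L.H * L.cov2 X α) α μ := fun μ => by
      simp only [div2, Matrix.mul_apply]
    have h6 : L.div2 (L.sq X) ν = ∑ α, (L.H * L.cov2 X α * (L.H * Xᵀ)) α ν
        + ∑ α, (P * (L.cov2 X α)ᵀ) α ν := by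
      simp only [← Finset.sum_add_distrib, ← Matrix.add_apply, hP, div2]
      refine Finset.sum_congr rfl fun α _ => ?_
      rw [hsq, ← Matrix.mul_apply]
      refine congrFun (congrFun (?_ : (_ : Matrix ι ι R) = _) α) ν
      noncomm_ring
    rw [h6]
    congr 1
    simp only [Matrix.mul_apply (M := L.H * L.cov2 X _), Matrix.mul_apply (M := L.H) (N := Xᵀ)]
    rw [Finset.sum_comm]
    simp only [← Finset.sum_mul, ← h5, contr, hXt, Matrix.neg_apply, mul_neg,
      Finset.sum_neg_distrib]
    congr 1
    simp only [Finset.mul_sum, Finset.sum_mul]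
    rw [Finset.sum_comm]
    exact Finset.sum_congr rfl fun _ _ => Finset.sum_congr rfl fun _ _ => by
      rw [L.H_symm]; ring
  have h2 : L.d ν (L.tr2 (L.sq X)) = 2 * ∑ α, ∑ κ, P α κ * L.cov2 X ν α κ := by
    have h5 : (P * (L.cov2 X ν)ᵀ).trace = ∑ α, ∑ κ, P α κ * L.cov2 X ν α κ := by
      simp only [Matrix.trace, Matrix.diag_apply, Matrix.mul_apply (M := P), transpose_apply]
    have h6 : (L.H * (L.cov2 X ν * L.H * Xᵀ)ᵀ).trace = (P * (L.cov2 X ν)ᵀ).trace := by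
      rw [hP, transpose_mul, transpose_mul, transpose_H, transpose_transpose]
      simp only [mul_assoc]
    have h7 : (L.H * (X * L.H * (L.cov2 X ν)ᵀ)ᵀ).trace = (P * (L.cov2 X ν)ᵀ).trace := by
      rw [← trace_transpose, transpose_mul, transpose_transpose, transpose_H, trace_mul_comm, hP]
      simp only [mul_assoc]
    rw [d_tr2, tr2_eq, hsq, transpose_add, mul_add, trace_add, h6, h7, h5]
    ring
  have h3 : ∑ α, ∑ κ, P α κ * L.cov2 X α ν κ = ∑ α, ∑ κ, P α κ * L.cov2 X κ α ν := by
    rw [Finset.sum_comm]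
    exact Finset.sum_congr rfl fun α _ => Finset.sum_congr rfl fun κ _ => by
      rw [hP_symm, hcov]; ring
  -- Contracted with the skew `P`, two of the three cyclic terms coincide (`h3`). Hence each is half
  -- of the contraction of `P` with ∇_ν X, which is a quarter of the derivative of the trace.
  have h4 : ∑ α, ∑ κ, P α κ * (L.cov2 X α ν κ - L.cov2 X ν α κ + L.cov2 X κ α ν) = 0 := by
    refine Finset.sum_eq_zero fun α _ => Finset.sum_eq_zero fun κ _ => ?_
    rw [hcov ν α κ]
    linear_combination P α κ * L.cov2_curl_cyclic w α ν κ
  simp only [mul_add, mul_sub, Finset.sum_add_distrib, Finset.sum_sub_distrib] at h4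
  rw [h1, h2]
  linear_combination 2 * h4 + 2 * h3

end LeviCivita

end

/-! ### Consequences of the field equations: divergence and trace of the field tensor. -/

section

namespace LeviCivita

open Matrix Finset

variable {ι R : Type*} [Fintype ι] [DecidableEq ι] [CommRing R] [Algebra ℝ R]
  (L : LeviCivita ι R)

lemma contr_sub_right (u : ι → R) (X Y : Matrix ι ι R) (ν : ι) :
    L.contr u (X - Y) ν = L.contr u X ν - L.contr u Y ν := by
  simp only [contr, Matrix.sub_apply, mul_sub, Finset.sum_sub_distrib]

lemma contr_add_right (u : ι → R) (X Y : Matrix ι ι R) (ν : ι) :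
    L.contr u (X + Y) ν = L.contr u X ν + L.contr u Y ν := by
  simp only [contr, Matrix.add_apply, mul_add, Finset.sum_add_distrib]

lemma contr_smul_right (f : R) (u : ι → R) (X : Matrix ι ι R) (ν : ι) :
    L.contr u (f • X) ν = f * L.contr u X ν := by
  simp only [contr, Matrix.smul_apply, smul_eq_mul, Finset.mul_sum]
  exact Finset.sum_congr rfl fun _ _ => Finset.sum_congr rfl fun _ _ => by ring

lemma contr_sub_left (u v : ι → R) (X : Matrix ι ι R) (ν : ι) :
    L.contr (u - v) X ν = L.contr u X ν - L.contr v X ν := by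
  simp only [contr, Pi.sub_apply, mul_sub, sub_mul, Finset.sum_sub_distrib]

lemma contr_smul_left (f : R) (u : ι → R) (X : Matrix ι ι R) (ν : ι) :
    L.contr (f • u) X ν = f * L.contr u X ν := by
  simp only [contr, Pi.smul_apply, smul_eq_mul, Finset.mul_sum]
  exact Finset.sum_congr rfl fun _ _ => Finset.sum_congr rfl fun _ _ => by ring

lemma contr_outer (u v w : ι → R) (ν : ι) : L.contr u (outer v w) ν = L.dot u v * w ν := by
  rw [dot_comm]
  simp only [contr, dot, outer, Matrix.of_apply, Finset.sum_mul]
  exact Finset.sum_congr rfl fun _ _ => Finset.sum_congr rfl fun _ _ => by ring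

lemma contr_bl (u v w : ι → R) (ν : ι) :
    L.contr u (L.bl v w) ν = L.dot u v * w ν + L.dot u w * v ν - L.dot v w * u ν := by
  simp only [bl, contr_sub_right, contr_add_right, contr_outer, contr_smul_right, contr_g]

lemma cov1_smul (f : R) (w : ι → R) :
    L.cov1 (f • w) = outer (L.grad f) w + f • L.cov1 w := by
  ext μ ν
  have h : ∑ κ, L.A μ κ ν * (f * w κ) = f * ∑ κ, L.A μ κ ν * w κ := by
    rw [Finset.mul_sum]; exact Finset.sum_congr rfl fun _ _ => by ring
  simp only [cov1, outer, grad, Matrix.of_apply, Matrix.add_apply, Matrix.smul_apply,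
    Pi.smul_apply, smul_eq_mul, Derivation.leibniz, h]
  ring

lemma cov1_sub (u w : ι → R) : L.cov1 (u - w) = L.cov1 u - L.cov1 w := by
  ext μ ν
  simp only [cov1, Matrix.of_apply, Matrix.sub_apply, Pi.sub_apply, map_sub, mul_sub,
    Finset.sum_sub_distrib]
  ring

lemma div1_smul (f : R) (w : ι → R) : L.div1 (f • w) = L.dot (L.grad f) w + f * L.div1 w := by
  change L.tr2 _ = _ + f * L.tr2 _
  rw [cov1_smul, tr2_add, tr2_outer, tr2_smul]

lemma div1_sub (u w : ι → R) : L.div1 (u - w) = L.div1 u - L.div1 w := by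
  change L.tr2 _ = L.tr2 _ - L.tr2 _
  rw [cov1_sub, tr2_sub]

lemma grad_sq (f : R) : L.grad (f ^ 2) = (2 * f) • L.grad f := by
  ext μ
  simp [grad, Derivation.leibniz_pow]
  ring

lemma dot_smul_left (f : R) (u w : ι → R) : L.dot (f • u) w = f * L.dot u w := by
  simp only [dot, Pi.smul_apply, smul_eq_mul, Finset.mul_sum]
  exact Finset.sum_congr rfl fun _ _ => Finset.sum_congr rfl fun _ _ => by ring

lemma grad_const_mul {a : R} (ha : ∀ μ, L.d μ a = 0) (f : R) :
    L.grad (a * f) = a • L.grad f := by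
  ext μ; simp [grad, ha]

/-- The divergence of the gradient of the square of a function. -/
lemma div1_grad_sq (f : R) :
    L.div1 (L.grad (f ^ 2)) = 2 * f * L.div1 (L.grad f) + 2 * L.dot (L.grad f) (L.grad f) := by
  have h2 : ∀ μ, L.d μ (2 : R) = 0 := fun μ => by
    have := (L.d μ).map_natCast 2
    simpa using this
  rw [grad_sq, div1_smul, grad_const_mul L h2, dot_smul_left]
  ring

-- The powers of `h` in `fieldTensor` go up to h³. Multiplying by eight allows integer coefficients
-- in the two final combinations.
omit [Algebra ℝ R] in
lemma eq_zero_of_eight_mul {h x : R} (hh : 8 * h * h * h = 1) (hx : 8 * x = 0) : x = 0 := by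
  linear_combination h * h * h * hx - x * hh

/-! ### The field equations -/

section FieldEquations

variable (om b lam h φ : R) (Q : ι → R)

/-- The left-hand side of the metric field equation, multiplied by `φ²`; the element `h` is meant to
be `1 / 2` and `b` is the square of the coupling constant of the vector field. -/
def fieldTensor : Matrix ι ι R :=
  φ ^ 2 • (L.ric - (h * L.tr2 L.ric) • L.g)
    - (L.cov1 (L.grad (φ ^ 2)) - L.div1 (L.grad (φ ^ 2)) • L.g)
    + (om * h) • L.bl (L.grad φ) (L.grad φ)
    + ((om - 6) * h * h * h) • φ ^ 2 • L.bl Q Q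
    - ((om - 6) * h * h) • L.bl (L.grad (φ ^ 2)) Q
    - b • (L.sq (L.curl Q) - (h * h * L.tr2 (L.sq (L.curl Q))) • L.g)
    + (lam * h * h * h * φ ^ 4) • L.g

/-- The field equation of the vector field. -/
def Proca : Prop :=
  ∀ ν, 4 * b * L.div2 (L.curl Q) ν = (6 - om) * (φ ^ 2 * Q ν - L.d ν (φ ^ 2))

/-- The field equation of the scalar field, multiplied by `φ²`. -/
def ScalarEq : Prop :=
  φ ^ 2 * L.tr2 L.ric + om * L.dot (L.grad φ) (L.grad φ) - om * h * L.div1 (L.grad (φ ^ 2))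
    + (om - 6) * h * h * φ ^ 2 * L.dot Q Q + (om - 6) * h * φ ^ 2 * L.div1 Q
    - lam * h * φ ^ 4 = 0

variable {om b lam h φ Q}

/-- The left-hand side of the vector equation is divergence-free by `div1_div2`. The factor 6 - ω is
kept, so ω = 6 needs no separate treatment. -/
lemma Proca.divergence (hom : ∀ μ, L.d μ om = 0) (hb : ∀ μ, L.d μ b = 0)
    (hP : L.Proca om b φ Q) :
    (6 - om) * (L.dot (L.grad (φ ^ 2)) Q + φ ^ 2 * L.div1 Q - L.div1 (L.grad (φ ^ 2))) = 0 := by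
  have hconst : ∀ (a : R) (w : ι → R), (∀ μ, L.d μ a = 0) → L.div1 (a • w) = a * L.div1 w :=
    fun a w ha => by
      rw [div1_smul]
      simp [dot, grad, ha]
  have hnat : ∀ (n : ℕ) μ, L.d μ (n : R) = 0 := fun n μ => (L.d μ).map_natCast n
  have h4 : ∀ μ, L.d μ (4 : R) = 0 := fun μ => by simpa using hnat 4 μ
  have h6 : ∀ μ, L.d μ (6 : R) = 0 := fun μ => by simpa using hnat 6 μ
  have h : (4 * b) • L.div2 (L.curl Q) = (6 - om) • (φ ^ 2 • Q - L.grad (φ ^ 2)) :=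
    funext hP
  have h1 := congrArg L.div1 h
  rw [hconst _ _ (by simp [h4, hb]), L.div1_div2 (L.curl_transpose Q),
    hconst _ _ (by simp [h6, hom]), div1_sub, div1_smul] at h1
  linear_combination -h1

/-- The field equations of the vector field and of the scalar field imply that the left-hand side of
the metric field equation is conserved. -/
lemma mul_div2_fieldTensor (hom : ∀ μ, L.d μ om = 0) (hb : ∀ μ, L.d μ b = 0)
    (hlam : ∀ μ, L.d μ lam = 0) (hh : ∀ μ, L.d μ h = 0) (hh2 : 2 * h = 1)
    (hP : L.Proca om b φ Q) (hS : L.ScalarEq om lam h φ Q) (ν : ι) :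
    φ * L.div2 (L.fieldTensor om b lam h φ Q) ν = 0 := by
  have h6 : ∀ μ, L.d μ (6 : R) = 0 := fun μ => by simpa using (L.d μ).map_natCast 6
  have e1 : L.div2 (φ ^ 2 • (L.ric - (h * L.tr2 L.ric) • L.g)) ν
      = L.contr (L.grad (φ ^ 2)) L.ric ν - h * L.tr2 L.ric * L.d ν (φ ^ 2) := by
    rw [div2_smul, div2_sub, div2_smul_g, contr_sub_right, contr_smul_right, contr_g]
    simp only [Derivation.leibniz, smul_eq_mul, hh, d_tr2_ric, grad]
    linear_combination -φ ^ 2 * L.div2 L.ric ν * hh2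
  have e2 : L.div2 (L.cov1 (L.grad (φ ^ 2)) - L.div1 (L.grad (φ ^ 2)) • L.g) ν
      = L.contr (L.grad (φ ^ 2)) L.ric ν := by
    rw [div2_sub, div2_smul_g, div2_hess]
    ring
  have e3 : L.div2 ((om * h) • L.bl (L.grad φ) (L.grad φ)) ν
      = om * h * (2 * L.div1 (L.grad φ) * L.d ν φ) := by
    rw [div2_const_smul _ (by simp [hom, hh]), div2_bl, curl_grad, contr_zero, grad]
    ring
  have e4 : L.div2 (((om - 6) * h * h * h) • φ ^ 2 • L.bl Q Q) ν = (om - 6) * h * h * h *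
      (2 * L.dot (L.grad (φ ^ 2)) Q * Q ν - L.dot Q Q * L.d ν (φ ^ 2)
        + φ ^ 2 * (2 * L.div1 Q * Q ν + 2 * L.contr Q (L.curl Q) ν)) := by
    rw [div2_const_smul _ (by simp [hom, hh, h6]), div2_smul, div2_bl, contr_bl]
    simp only [grad]
    ring
  have e5 : L.div2 (((om - 6) * h * h) • L.bl (L.grad (φ ^ 2)) Q) ν = (om - 6) * h * h *
      (L.div1 (L.grad (φ ^ 2)) * Q ν + L.div1 Q * L.d ν (φ ^ 2)
        + L.contr (L.grad (φ ^ 2)) (L.curl Q) ν) := by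
    rw [div2_const_smul _ (by simp [hom, hh, h6]), div2_bl, curl_grad, contr_zero]
    simp only [grad]
    ring
  have e6 : L.div2 (b • (L.sq (L.curl Q) - (h * h * L.tr2 (L.sq (L.curl Q))) • L.g)) ν
      = -b * L.contr (L.div2 (L.curl Q)) (L.curl Q) ν := by
    rw [div2_const_smul _ hb, div2_sub, div2_smul_g]
    have := L.div2_sq_curl Q ν
    have hhh : 4 * h * h = 1 := by linear_combination (2 * h + 1) * hh2
    simp only [Derivation.leibniz, smul_eq_mul, hh]
    linear_combination b * h * h * this - b * (L.div2 (L.sq (L.curl Q)) ν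
      + L.contr (L.div2 (L.curl Q)) (L.curl Q) ν) * hhh
  have e7 : L.div2 ((lam * h * h * h * φ ^ 4) • L.g) ν
      = lam * h * h * h * (4 * φ ^ 3 * L.d ν φ) := by
    rw [div2_smul_g]
    simp [hh, hlam, Derivation.leibniz_pow]
    ring
  have hsq : L.d ν (φ ^ 2) = 2 * φ * L.d ν φ := congrFun (L.grad_sq φ) ν
  have hP1 : (4 * b) • L.div2 (L.curl Q) = (6 - om) • (φ ^ 2 • Q - L.grad (φ ^ 2)) :=
    funext hP
  have hP2 : 4 * b * L.contr (L.div2 (L.curl Q)) (L.curl Q) ν = (6 - om) *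
      (φ ^ 2 * L.contr Q (L.curl Q) ν - L.contr (L.grad (φ ^ 2)) (L.curl Q) ν) := by
    rw [← contr_smul_left, hP1, contr_smul_left, contr_sub_left, contr_smul_left]
  have hP3 := Proca.divergence L hom hb hP
  rw [fieldTensor, div2_add, div2_sub, div2_sub, div2_add, div2_add, div2_sub, e1, e2, e3, e4, e5,
    e6, e7]
  -- The kinetic term of φ produces □φ, while the scalar equation contains □φ². Passing from one to
  -- the other requires φ□φ, which is one reason for the factor `φ` in the statement.
  have hbox := L.div1_grad_sq φ
  unfold ScalarEq at hS
  rw [hsq]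
  have hh4 : 4 * h * h = 1 := by linear_combination (2 * h + 1) * hh2
  have hh8 : 8 * h * h * h = 1 := by linear_combination hh4 + 4 * h * h * hh2
  generalize L.contr (L.div2 (L.curl Q)) (L.curl Q) ν = J at *
  generalize L.contr (L.grad (φ ^ 2)) (L.curl Q) ν = Y at *
  generalize L.contr Q (L.curl Q) ν = X at *
  generalize L.contr (L.grad (φ ^ 2)) L.ric ν = K at *
  generalize L.div1 (L.grad (φ ^ 2)) = B at *
  generalize L.div1 (L.grad φ) = B' at *
  generalize L.dot (L.grad φ) (L.grad φ) = N at *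
  generalize L.dot (L.grad (φ ^ 2)) Q = S at *
  generalize L.dot Q Q = N' at *
  generalize L.div1 Q = V at *
  generalize L.tr2 L.ric = ρ at *
  generalize L.d ν φ = f at *
  generalize Q ν = q at *
  refine eq_zero_of_eight_mul hh8 ?_
  -- The mathematics is in the first line: the vector equation contracted with the field strength,
  -- its divergence times Q_ν, the scalar equation times ∂_νφ, and the formula for □φ². The
  -- multiples of `hh2`, `hh4` and `hh8` only substitute one half for `h`.
  linear_combination 2 * φ * hP2 - 2 * φ * q * hP3 - 8 * f * hS - 4 * om * f * hbox
    + (4 * φ * (-2 * ρ * φ * f + 2 * om * B' * f)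
      + 4 * f * (-om * B + (om - 6) * φ ^ 2 * V - lam * φ ^ 4)) * hh2
    + (-2 * φ * (om - 6) * (B * q + 2 * V * φ * f + Y)
      + 2 * f * (om - 6) * φ ^ 2 * N') * hh4
    + (φ * ((om - 6) * (2 * S * q - 2 * N' * φ * f + 2 * φ ^ 2 * (V * q + X))
      + 4 * lam * φ ^ 3 * f)) * hh8

/-- The trace is minus the scalar equation plus (ω-6)/2 times the divergence of φ²Q - ∂φ², which is
the Noether identity of the gauge symmetry. Dimension four makes the trace of the field-strength
term vanish and fixes the coefficients of the other terms. -/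
lemma tr2_fieldTensor (hι : Fintype.card ι = 4) (hom : ∀ μ, L.d μ om = 0)
    (hb : ∀ μ, L.d μ b = 0) (hh2 : 2 * h = 1)
    (hP : L.Proca om b φ Q) (hS : L.ScalarEq om lam h φ Q) :
    L.tr2 (L.fieldTensor om b lam h φ Q) = 0 := by
  have hcard : L.tr2 L.g = 4 := by rw [tr2_g, hι]; simp
  have hP3 := Proca.divergence L hom hb hP
  have hdiv : L.tr2 (L.cov1 (L.grad (φ ^ 2))) = L.div1 (L.grad (φ ^ 2)) := rfl
  simp only [fieldTensor, bl, tr2_add, tr2_sub, tr2_smul, tr2_outer, hcard, hdiv,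
    L.dot_comm Q (L.grad _)]
  unfold ScalarEq at hS
  have hh4 : 4 * h * h = 1 := by linear_combination (2 * h + 1) * hh2
  have hh8 : 8 * h * h * h = 1 := by linear_combination hh4 + 4 * h * h * hh2
  generalize L.div1 (L.grad (φ ^ 2)) = B at *
  generalize L.dot (L.grad φ) (L.grad φ) = N at *
  generalize L.dot (L.grad (φ ^ 2)) Q = S at *
  generalize L.dot Q Q = N' at *
  generalize L.div1 Q = V at *
  generalize L.tr2 L.ric = ρ at *
  generalize L.tr2 (L.sq (L.curl Q)) = σ at *
  refine eq_zero_of_eight_mul hh8 ?_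
  linear_combination -8 * hS - 4 * hP3
    + (4 * (-4 * φ ^ 2 * ρ - 2 * om * N)
      + 4 * (-om * B + (om - 6) * φ ^ 2 * V - lam * φ ^ 4)) * hh2
    + (2 * (2 * (om - 6) * S + 4 * b * σ) + 2 * (om - 6) * φ ^ 2 * N') * hh4
    + (-2 * (om - 6) * φ ^ 2 * N' + 4 * lam * φ ^ 4) * hh8

end FieldEquations

end LeviCivita

end

/-! ### Null streams and the Levi-Civita connection of a metric. -/

section

namespace LeviCivita

open Matrix Finset

variable {ι R : Type*} [Fintype ι] [DecidableEq ι] [CommRing R] [Algebra ℝ R]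
  (L : LeviCivita ι R)

/-- A traceless and conserved coherent stream of matter moves on null curves whose acceleration is
proportional to the velocity; the factor is determined by the exterior derivative of the
covector field of the stream. -/
lemma stream {ρ ρ' : R} (hρ : ρ * ρ' = 1) (v : ι → R)
    (htr : L.tr2 (ρ • outer (L.g *ᵥ v) (L.g *ᵥ v)) = 0)
    (hdiv : ∀ ν, L.div2 (ρ • outer (L.g *ᵥ v) (L.g *ᵥ v)) ν = 0) :
    ∑ μ, ∑ ν, L.g μ ν * v μ * v ν = 0 ∧
    ∃ f, (∀ ν, ∑ α, v α * L.curl (L.g *ᵥ v) α ν = f * (L.g *ᵥ v) ν) ∧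
      ∀ β, ∑ α, v α * L.d α (v β) + ∑ α, ∑ γ, L.A α β γ * v α * v γ = f * v β := by
  set k := L.g *ᵥ v with hk
  have hv : L.H *ᵥ k = v := by rw [hk, mulVec_mulVec, H_mul_g, one_mulVec]
  have hcontr : ∀ X ν, L.contr k X ν = ∑ α, v α * X α ν := fun X ν => by
    simp only [contr, ← Finset.sum_mul]
    exact Finset.sum_congr rfl fun α _ => by rw [← congrFun hv α, Matrix.mulVec, dotProduct]
  have hdot : L.dot k k = 0 := by
    rw [tr2_smul, tr2_outer] at htr
    linear_combination ρ' * htr - L.dot k k * hρ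
  have hdot2 : L.dot k k = ∑ μ, ∑ ν, L.g μ ν * v μ * v ν := by
    have h : ∀ μ, ∑ ν, L.H μ ν * k μ * k ν = k μ * (L.H *ᵥ k) μ := fun μ => by
      simp only [Matrix.mulVec, dotProduct, Finset.mul_sum]
      exact Finset.sum_congr rfl fun _ _ => by ring
    simp only [dot, h, hv]
    simp only [hk, Matrix.mulVec, dotProduct, Finset.sum_mul]
    exact Finset.sum_congr rfl fun _ _ => Finset.sum_congr rfl fun _ _ => by ring
  -- Reading ρ k⊗k as (ρk)⊗k, the product rule gives ∇·(ρk) k_ν + ρ k^α∇_αk_ν = 0, and ρ is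
  -- invertible.
  have hcov : ∀ ν, L.contr k (L.cov1 k) ν = -(ρ' * L.div1 (ρ • k)) * k ν := fun ν => by
    have h : ρ • outer k k = outer (ρ • k) k := by
      ext; simp [outer, mul_assoc]
    have h2 := hdiv ν
    rw [h, div2_outer, contr_smul_left] at h2
    linear_combination ρ' * h2 - L.contr k (L.cov1 k) ν * hρ
  refine ⟨hdot2 ▸ hdot, -(ρ' * L.div1 (ρ • k)), fun ν => ?_, fun β => ?_⟩
  · have h := L.d_dot ν k k
    rw [hdot, map_zero] at h
    simp only [← two_mul, mul_left_comm _ (2 : R), ← Finset.mul_sum] at h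
    -- Differentiating k·k = 0 gives k^α∇_νk_α = 0, so contracting k with its exterior derivative
    -- gives the acceleration covector.
    have h2 : ∑ α, ∑ μ, L.H α μ * (k μ * L.cov1 k ν α) = 0 :=
      eq_zero_of_eq_neg (by linear_combination -h)
    rw [← hcontr, contr_curl, h2, hcov, sub_zero]
  · have h : ∀ α, L.d α (v β) + ∑ γ, L.A α β γ * v γ = ∑ ν, L.H β ν * L.cov1 k α ν := fun α => by
      have := congrFun (L.H_mulVec_cov1 k α) β
      rw [hv] at this
      exact this.symm
    calc _ = ∑ α, v α * (L.d α (v β) + ∑ γ, L.A α β γ * v γ) := by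
          simp only [mul_add, Finset.sum_add_distrib, Finset.mul_sum]
          congr 1
          exact Finset.sum_congr rfl fun _ _ => Finset.sum_congr rfl fun _ _ => by ring
      _ = ∑ ν, L.H β ν * L.contr k (L.cov1 k) ν := by
          simp only [h, hcontr, Finset.mul_sum]
          rw [Finset.sum_comm]
          exact Finset.sum_congr rfl fun _ _ => Finset.sum_congr rfl fun _ _ => by ring
      _ = _ := by
          rw [← congrFun hv β, Matrix.mulVec, dotProduct, Finset.mul_sum]
          exact Finset.sum_congr rfl fun _ _ => by rw [hcov]; ring

/-- The Levi-Civita connection of a metric. -/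
def ofMetric (d : ι → Derivation ℝ R R) (d_comm : ∀ i j f, d i (d j f) = d j (d i f))
    (g H : Matrix ι ι R) (g_symm : g.transpose = g) (g_mul_H : g * H = 1) : LeviCivita ι R where
  d := d
  d_comm := d_comm
  g := g
  H := H
  A μ := Matrix.of fun α ν => algebraMap ℝ R (1 / 2) *
    ∑ l, H α l * (d ν (g μ l) + d μ (g ν l) - d l (g μ ν))
  g_symm := g_symm
  g_mul_H := g_mul_H
  A_symm μ ν α := by
    have hg : g μ ν = g ν μ := congrFun (congrFun g_symm ν) μ
    simp only [Matrix.of_apply, hg]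
    congr 1
    exact Finset.sum_congr rfl fun _ _ => by ring
  compat α := by
    have hg : ∀ μ ν, g μ ν = g ν μ := fun μ ν => congrFun (congrFun g_symm ν) μ
    have h : ∀ μ ν, ∑ κ, g μ κ * (algebraMap ℝ R (1 / 2) *
        ∑ l, H κ l * (d ν (g α l) + d α (g ν l) - d l (g α ν)))
        = algebraMap ℝ R (1 / 2) * (d ν (g α μ) + d α (g ν μ) - d μ (g α ν)) := fun μ ν => by
      have h2 := congrFun (congrArg (fun X => X *ᵥ fun l => d ν (g α l) + d α (g ν l)
        - d l (g α ν)) g_mul_H) μ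
      simp only [one_mulVec, ← mulVec_mulVec] at h2
      rw [← h2]
      simp only [Matrix.mulVec, dotProduct, Finset.mul_sum]
      exact Finset.sum_congr rfl fun _ _ => Finset.sum_congr rfl fun _ _ => by ring
    have h2 : 2 * algebraMap ℝ R (1 / 2) = 1 := by
      rw [← map_ofNat (algebraMap ℝ R) 2, ← map_mul]; norm_num
    ext μ ν
    have h3 := h μ ν
    have h4 := h ν μ
    simp only [Matrix.map_apply, Matrix.add_apply, Matrix.mul_apply, transpose_apply,
      Matrix.of_apply]
    rw [h3, Finset.sum_congr rfl fun κ _ => (mul_comm _ (g κ ν)).trans (by rw [hg κ ν]), h4,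
      hg α μ, hg α ν, hg ν μ]
    linear_combination -d α (g μ ν) * h2

end LeviCivita

end

/-! ### The ring of smooth functions on an open subset of ℝ⁴. -/

section

open TopologicalSpace

/-- The algebra of smooth functions on an open subset of `ℝ⁴`. -/
def SmoothFun (U : Opens E4) : Subalgebra ℝ (U → ℝ) where
  carrier := {f | ∃ F : E4 → ℝ, ContDiffOn ℝ ∞ F U ∧ ∀ y : U, F y = f y}
  mul_mem' := by
    rintro f f' ⟨F, hF, h⟩ ⟨F', hF', h'⟩
    exact ⟨F * F', hF.mul hF', fun y => by simp [h, h']⟩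
  add_mem' := by
    rintro f f' ⟨F, hF, h⟩ ⟨F', hF', h'⟩
    exact ⟨F + F', hF.add hF', fun y => by simp [h, h']⟩
  algebraMap_mem' r := ⟨fun _ => r, contDiffOn_const, fun _ => rfl⟩

namespace SmoothFun

variable {U : Opens E4}

/-- Evaluation at a point. -/
def ev (y : U) : SmoothFun U →ₐ[ℝ] ℝ := (Pi.evalAlgHom ℝ (fun _ : U => ℝ) y).comp (SmoothFun U).val

lemma ext_ev {f f' : SmoothFun U} (h : ∀ y, ev y f = ev y f') : f = f' :=
  Subtype.ext (funext h)

/-- The function `F` of the coordinates restricts to `f`. -/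
def Rep (F : E4 → ℝ) (f : SmoothFun U) : Prop := ∀ y : U, F y = ev y f

/-- The restriction of a smooth function. -/
def res (F : E4 → ℝ) (hF : ContDiffOn ℝ ∞ F U) : SmoothFun U := ⟨fun y => F y, F, hF, fun _ => rfl⟩

lemma rep_res (F : E4 → ℝ) (hF : ContDiffOn ℝ ∞ F U) : Rep F (res F hF) := fun _ => rfl

lemma Rep.contDiffOn {F : E4 → ℝ} {f : SmoothFun U} (h : Rep F f) : ContDiffOn ℝ ∞ F U := by
  obtain ⟨f, F', hF', h'⟩ := f
  exact hF'.congr fun y hy => (h ⟨y, hy⟩).trans (h' ⟨y, hy⟩).symm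

lemma exists_rep (f : SmoothFun U) : ∃ F, Rep F f := by
  obtain ⟨f, F, hF, h⟩ := f
  exact ⟨F, h⟩

lemma pd_congr {F F' : E4 → ℝ} (h : ∀ y ∈ U, F y = F' y) (μ : Fin 4) {x : E4} (hx : x ∈ U) :
    Coord.pd μ F x = Coord.pd μ F' x := by
  unfold Coord.pd
  rw [Filter.EventuallyEq.fderiv_eq]
  filter_upwards [U.isOpen.mem_nhds hx] with y hy using h y hy

lemma contDiffOn_pd {F : E4 → ℝ} (hF : ContDiffOn ℝ ∞ F U) (μ : Fin 4) :
    ContDiffOn ℝ ∞ (Coord.pd μ F) U :=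
  (hF.fderiv_of_isOpen U.isOpen (m := ∞) (by simp)).clm_apply contDiffOn_const

lemma Rep.differentiableAt {F : E4 → ℝ} {f : SmoothFun U} (h : Rep F f) (y : U) :
    DifferentiableAt ℝ F y :=
  (h.contDiffOn.contDiffAt (U.isOpen.mem_nhds y.2)).differentiableAt (by simp)

/-- The partial derivatives. -/
def d (μ : Fin 4) : Derivation ℝ (SmoothFun U) (SmoothFun U) :=
  let D : SmoothFun U → SmoothFun U := fun f =>
    res (Coord.pd μ (exists_rep f).choose) (contDiffOn_pd (exists_rep f).choose_spec.contDiffOn μ)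
  -- On the open set `U` a partial derivative depends only on the values on `U`. The chosen
  -- extension is therefore irrelevant, and linearity and the Leibniz rule may be checked on
  -- convenient representatives.
  have hD : ∀ {F f}, Rep F f → Rep (Coord.pd μ F) (D f) := fun {F f} h y =>
    pd_congr (fun y hy => (h ⟨y, hy⟩).trans ((exists_rep f).choose_spec ⟨y, hy⟩).symm) μ y.2
  Derivation.mk'
    { toFun := D
      map_add' := fun f f' => by
        obtain ⟨F, h⟩ := exists_rep f
        obtain ⟨F', h'⟩ := exists_rep f'
        have h2 : Rep (F + F') (f + f') := fun y => by simp [h y, h' y]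
        refine ext_ev fun y => ?_
        rw [← hD h2, map_add, ← hD h, ← hD h']
        simp [Coord.pd, fderiv_add (h.differentiableAt y) (h'.differentiableAt y)]
      map_smul' := fun r f => by
        obtain ⟨F, h⟩ := exists_rep f
        have h2 : Rep (r • F) (r • f) := fun y => by simp [h y]
        refine ext_ev fun y => ?_
        rw [← hD h2, RingHom.id_apply, map_smul, ← hD h]
        simp [Coord.pd, fderiv_const_smul (h.differentiableAt y)] }
    fun f f' => by
      obtain ⟨F, h⟩ := exists_rep f
      obtain ⟨F', h'⟩ := exists_rep f'
      have h2 : Rep (F * F') (f * f') := fun y => by simp [h y, h' y]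
      refine ext_ev fun y => ?_
      change ev y (D (f * f')) = ev y (f • D f' + f' • D f)
      rw [← hD h2, map_add, smul_eq_mul, smul_eq_mul, map_mul, map_mul, ← hD h, ← hD h', ← h y,
        ← h' y]
      simp [Coord.pd, fderiv_mul (h.differentiableAt y) (h'.differentiableAt y)]

lemma Rep.pd {F : E4 → ℝ} {f : SmoothFun U} (h : Rep F f) (μ : Fin 4) :
    Rep (Coord.pd μ F) (d μ f) := fun y =>
  pd_congr (fun y hy => (h ⟨y, hy⟩).trans ((exists_rep f).choose_spec ⟨y, hy⟩).symm) μ y.2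

lemma d_comm (μ ν : Fin 4) (f : SmoothFun U) : d μ (d ν f) = d ν (d μ f) := by
  obtain ⟨F, h⟩ := exists_rep f
  refine ext_ev fun y => ?_
  rw [← (h.pd ν).pd μ y, ← (h.pd μ).pd ν y]
  have hF : ContDiffAt ℝ ∞ F y := h.contDiffOn.contDiffAt (U.isOpen.mem_nhds y.2)
  have hd : DifferentiableAt ℝ (fderiv ℝ F) y :=
    (hF.fderiv_right (m := 1) (WithTop.coe_le_coe.2 (le_top : (2 : ℕ∞) ≤ ⊤))).differentiableAt (by simp)
  have h2 : ∀ μ ν, Coord.pd μ (Coord.pd ν F) y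
      = fderiv ℝ (fderiv ℝ F) y (EuclideanSpace.single μ 1) (EuclideanSpace.single ν 1) :=
    fun μ ν => by
      unfold Coord.pd
      rw [fderiv_clm_apply hd (differentiableAt_const _)]
      simp
  rw [h2, h2]
  exact (hF.isSymmSndFDerivAt (by simpa using WithTop.coe_le_coe.2 (le_top : (2 : ℕ∞) ≤ ⊤))) _ _

lemma isUnit_of_ev_ne_zero {f : SmoothFun U} (hf : ∀ y, ev y f ≠ 0) : IsUnit f := by
  obtain ⟨F, h⟩ := exists_rep f
  refine IsUnit.of_mul_eq_one (res (fun y => (F y)⁻¹)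
    (h.contDiffOn.inv fun y hy => by rw [h ⟨y, hy⟩]; exact hf _)) (ext_ev fun y => ?_)
  rw [map_mul, ← rep_res, ← h y, map_one, mul_inv_cancel₀]
  rw [h y]
  exact hf y

end SmoothFun

open SmoothFun Matrix

/-- A smooth metric in coordinates on an open set. -/
structure IsMetricOn (U : Opens E4) (G : E4 → Matrix (Fin 4) (Fin 4) ℝ) : Prop where
  smooth : ∀ μ ν, ContDiffOn ℝ ∞ (fun x => G x μ ν) U
  symm : ∀ x ∈ U, ∀ μ ν, G x μ ν = G x ν μ
  det_ne_zero : ∀ x ∈ U, (G x).det ≠ 0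

namespace IsMetricOn

variable {U : Opens E4} {G : E4 → Matrix (Fin 4) (Fin 4) ℝ} (hG : IsMetricOn U G)

def g : Matrix (Fin 4) (Fin 4) (SmoothFun U) := Matrix.of fun μ ν => res _ (hG.smooth μ ν)

lemma map_g (y : U) : hG.g.map (ev y) = G y := rfl

lemma isUnit_det : IsUnit hG.g.det :=
  isUnit_of_ev_ne_zero fun y => by
    have h := (ev y).toRingHom.map_det hG.g
    change ev y hG.g.det = (hG.g.map (ev y)).det at h
    rw [h, map_g]
    exact hG.det_ne_zero _ y.2

/-- The Levi-Civita connection of a metric in coordinates. -/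
def lc : LeviCivita (Fin 4) (SmoothFun U) :=
  LeviCivita.ofMetric d d_comm hG.g hG.g⁻¹
    (by ext μ ν y; exact hG.symm y y.2 ν μ)
    (Matrix.mul_nonsing_inv _ hG.isUnit_det)

end IsMetricOn

end

/-! ### Dictionary between coordinate formulas and the algebraic connection. -/

section

open TopologicalSpace SmoothFun Matrix

namespace SmoothFun

variable {U : Opens E4}

/-- The components of a covector field restrict to `w'`. -/
def RepV (w : E4 → Fin 4 → ℝ) (w' : Fin 4 → SmoothFun U) : Prop :=
  ∀ μ, Rep (fun y => w y μ) (w' μ)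

/-- The components of a 2-tensor field restrict to `X'`. -/
def RepM (X : E4 → Matrix (Fin 4) (Fin 4) ℝ) (X' : Matrix (Fin 4) (Fin 4) (SmoothFun U)) : Prop :=
  ∀ μ ν, Rep (fun y => X y μ ν) (X' μ ν)

lemma ev_algebraMap (y : U) (r : ℝ) : ev y (algebraMap ℝ (SmoothFun U) r) = r :=
  AlgHom.commutes _ _

end SmoothFun

namespace IsMetricOn

variable {U : Opens E4} {G : E4 → Matrix (Fin 4) (Fin 4) ℝ} (hG : IsMetricOn U G)

lemma rep_g : RepM G hG.lc.g := fun _ _ _ => rfl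

lemma rep_inv (μ ν : Fin 4) : Rep (fun y => Coord.inv G y μ ν) (hG.lc.H μ ν) := fun y => by
  have h : G y * (hG.lc.H.map (ev y)) = 1 := by
    have h2 := congrArg (fun X => X.map (ev y)) hG.lc.g_mul_H
    simp only [Matrix.map_mul] at h2
    rw [Matrix.map_one _ (map_zero _) (map_one _)] at h2
    exact h2
  exact congrFun (congrFun (Matrix.inv_eq_right_inv h) μ) ν

lemma rep_christoffel (α μ ν : Fin 4) :
    Rep (Coord.christoffel G α μ ν) (hG.lc.A μ α ν) := fun y => by
  have h : hG.lc.A μ α ν = algebraMap ℝ _ (1 / 2) * ∑ l, hG.lc.H α l *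
    (d ν (hG.lc.g μ l) + d μ (hG.lc.g ν l) - d l (hG.lc.g μ ν)) := rfl
  rw [h]
  simp only [Coord.christoffel, map_mul, map_sum, map_add, map_sub, ev_algebraMap]
  congr 1
  refine Finset.sum_congr rfl fun l _ => ?_
  rw [← (hG.rep_g μ l).pd, ← (hG.rep_g ν l).pd, ← (hG.rep_g μ ν).pd, ← hG.rep_inv]

lemma rep_riemann (α σ μ ν : Fin 4) :
    Rep (Coord.riemann G α σ μ ν) (hG.lc.F μ ν α σ) := fun y => by
  simp only [LeviCivita.F, Matrix.sub_apply, Matrix.add_apply, Matrix.mul_apply,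
    LeviCivita.D_apply, map_add, map_sub, map_sum, map_mul, Coord.riemann, Finset.sum_sub_distrib]
  rw [(hG.rep_christoffel α ν σ).pd μ, (hG.rep_christoffel α μ σ).pd ν]
  simp only [hG.rep_christoffel _ _ _ y]
  rw [← add_sub_assoc]
  rfl

lemma rep_ricci (μ ν : Fin 4) : Rep (Coord.ricci G μ ν) (hG.lc.ric μ ν) := fun y => by
  simp only [LeviCivita.ric, Matrix.of_apply, map_sum, Coord.ricci, hG.rep_riemann _ _ _ _ y]

lemma rep_trace {X X'} (hX : RepM X X') : Rep (Coord.trace G X) (hG.lc.tr2 X') := fun y => by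
  simp only [LeviCivita.tr2, map_sum, map_mul, Coord.trace, hG.rep_inv _ _ y, hX _ _ y]

lemma rep_scalarCurv : Rep (Coord.scalarCurv G) (hG.lc.tr2 hG.lc.ric) :=
  hG.rep_trace (X := fun y => Matrix.of fun μ ν => Coord.ricci G μ ν y) hG.rep_ricci

lemma rep_dot {u u' w w'} (hu : RepV u u') (hw : RepV w w') :
    Rep (Coord.dot G u w) (hG.lc.dot u' w') := fun y => by
  simp only [LeviCivita.dot, map_sum, map_mul, Coord.dot, hG.rep_inv _ _ y, hu _ y, hw _ y]

lemma rep_grad {f : E4 → ℝ} {f' : SmoothFun U} (hf : Rep f f') :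
    RepV (Coord.grad f) (hG.lc.grad f') := fun μ => hf.pd μ

lemma rep_nabla1 {w w'} (hw : RepV w w') (μ ν : Fin 4) :
    Rep (Coord.nabla1 G w μ ν) (hG.lc.cov1 w' μ ν) := fun y => by
  simp only [LeviCivita.cov1, Matrix.of_apply, map_sub, map_sum, map_mul, Coord.nabla1,
    hG.rep_christoffel _ _ _ y, hw _ y, (hw ν).pd μ y]
  rfl

lemma rep_nabla2 {X X'} (hX : RepM X X') (α μ ν : Fin 4) :
    Rep (Coord.nabla2 G X α μ ν) (hG.lc.cov2 X' α μ ν) := fun y => by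
  simp only [LeviCivita.cov2, Matrix.of_apply, map_sub, map_sum, map_mul, map_add, Coord.nabla2,
    hG.rep_christoffel _ _ _ y, hX _ _ y, (hX μ ν).pd α y]
  rfl

lemma rep_div1 {w w'} (hw : RepV w w') : Rep (Coord.div1 G w) (hG.lc.div1 w') := fun y => by
  simp only [LeviCivita.div1, map_sum, map_mul, Coord.div1, hG.rep_inv _ _ y,
    hG.rep_nabla1 hw _ _ y]

lemma rep_div2 {X X'} (hX : RepM X X') (ν : Fin 4) :
    Rep (Coord.div2 G X ν) (hG.lc.div2 X' ν) := fun y => by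
  simp only [LeviCivita.div2, map_sum, map_mul, Coord.div2, hG.rep_inv _ _ y,
    hG.rep_nabla2 hX _ _ _ y]

lemma rep_fieldStrength {w w'} (hw : RepV w w') :
    RepM (Coord.fieldStrength w) (hG.lc.curl w') := fun μ ν y => by
  simp only [LeviCivita.curl, Matrix.of_apply, map_sub, Coord.fieldStrength, (hw ν).pd μ y,
    (hw μ).pd ν y]
  rfl

lemma rep_strengthSq {w w'} (hw : RepV w w') (μ ν : Fin 4) :
    Rep (Coord.strengthSq G w μ ν) (hG.lc.sq (hG.lc.curl w') μ ν) := fun y => by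
  simp only [LeviCivita.sq, Matrix.of_apply, map_sum, map_mul, Coord.strengthSq,
    hG.rep_inv _ _ y, hG.rep_fieldStrength hw _ _ y]

lemma rep_strengthNorm {w w'} (hw : RepV w w') :
    Rep (Coord.strengthNorm G w) (hG.lc.tr2 (hG.lc.sq (hG.lc.curl w'))) :=
  hG.rep_trace (X := fun y => Matrix.of fun μ ν => Coord.strengthSq G w μ ν y)
    (hG.rep_strengthSq hw)

variable {om β lam : ℝ} {Q : E4 → Fin 4 → ℝ} {φ : E4 → ℝ} {Q' : Fin 4 → SmoothFun U}
  {φ' : SmoothFun U}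

/-- Multiplication by φ² clears every denominator of 𝓔, so the ring needs no inverse of φ; the
nonvanishing is used only pointwise. -/
lemma rep_calETotal (hφ0 : ∀ y ∈ U, φ y ≠ 0) (hQ : RepV Q Q') (hφ : Rep φ φ') :
    RepM (Coord.calETotal om β lam G Q φ)
      (hG.lc.fieldTensor (algebraMap ℝ _ om) (algebraMap ℝ _ (β ^ 2)) (algebraMap ℝ _ lam)
        (algebraMap ℝ _ (1 / 2)) φ' Q') := fun μ ν y => by
  have hφ2 : Rep (fun y => φ y ^ 2) (φ' ^ 2) := fun y => by rw [map_pow, ← hφ y]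
  have h0 : ev y φ' ≠ 0 := hφ y ▸ hφ0 y y.2
  have h6 : ev y (6 : SmoothFun U) = 6 := map_ofNat _ 6
  have hd : ∀ f μ, ev y (hG.lc.grad f μ) = ev y (d μ f) := fun _ _ => rfl
  simp only [LeviCivita.fieldTensor, LeviCivita.bl, LeviCivita.outer, Matrix.sub_apply,
    Matrix.add_apply, Matrix.smul_apply, smul_eq_mul, Matrix.of_apply, map_add, map_sub, map_mul,
    map_pow, ev_algebraMap, h6, hd, Coord.calETotal, Coord.calE, Coord.einstein, Coord.hess,
    Coord.box,
    hG.rep_ricci _ _ y, hG.rep_scalarCurv y, hG.rep_g _ _ y, hG.rep_nabla1 (hG.rep_grad hφ2) _ _ y,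
    hG.rep_div1 (hG.rep_grad hφ2) y, hG.rep_dot (hG.rep_grad hφ) (hG.rep_grad hφ) y,
    hG.rep_dot (hG.rep_grad hφ2) hQ y, hG.rep_dot hQ hQ y, hG.rep_strengthSq hQ _ _ y,
    hG.rep_strengthNorm hQ y, hφ y, hQ _ y, hφ.pd _ y, hφ2.pd _ y]
  field_simp
  ring

lemma calETotal_conserved (hG : IsMetricOn U G) (hφ0 : ∀ y ∈ U, φ y ≠ 0) (hβ : β ≠ 0) (hQ : RepV Q Q') (hφ : Rep φ φ')
    (hP : ∀ y ∈ U, Coord.ProcaAt om β G Q φ y) (hS : ∀ y ∈ U, Coord.ScalarAt om lam G Q φ y)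
    {x : E4} (hx : x ∈ U) :
    (∀ ν, Coord.div2 G (Coord.calETotal om β lam G Q φ) ν x = 0) ∧
      Coord.trace G (Coord.calETotal om β lam G Q φ) x = 0 := by
  have hφ2 : Rep (fun y => φ y ^ 2) (φ' ^ 2) := fun y => by rw [map_pow, ← hφ y]
  have hX := hG.rep_calETotal (om := om) (β := β) (lam := lam) hφ0 hQ hφ
  have hc : ∀ (r : ℝ) μ, hG.lc.d μ (algebraMap ℝ _ r) = 0 := fun r μ => Derivation.map_algebraMap _ _
  have hh2 : 2 * algebraMap ℝ (SmoothFun U) (1 / 2) = 1 := by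
    rw [← map_ofNat (algebraMap ℝ (SmoothFun U)) 2, ← map_mul]; norm_num
  have h4 : ∀ y : U, ev y (4 : SmoothFun U) = 4 := fun y => map_ofNat _ 4
  have h6 : ∀ y : U, ev y (6 : SmoothFun U) = 6 := fun y => map_ofNat _ 6
  have hP' : hG.lc.Proca (algebraMap ℝ _ om) (algebraMap ℝ _ (β ^ 2)) φ' Q' := fun ν => by
    refine ext_ev fun y => ?_
    have h := hP y y.2 ν
    rw [hG.rep_div2 (hG.rep_fieldStrength hQ) ν y, hφ2.pd ν y, hφ y, show Q y ν = ev y (Q' ν) from hQ ν y] at h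
    simp only [map_mul, map_sub, map_pow, ev_algebraMap, h4, h6]
    rw [h]
    field_simp
    rfl
  have hS' : hG.lc.ScalarEq (algebraMap ℝ _ om) (algebraMap ℝ _ lam) (algebraMap ℝ _ (1 / 2))
      φ' Q' := by
    refine ext_ev fun y => ?_
    have h := hS y y.2
    have h0 : ev y φ' ≠ 0 := hφ y ▸ hφ0 y y.2
    simp only [Coord.ScalarAt, Coord.box, hG.rep_scalarCurv y,
      hG.rep_dot (hG.rep_grad hφ) (hG.rep_grad hφ) y, hG.rep_div1 (hG.rep_grad hφ2) y,
      hG.rep_dot hQ hQ y, hG.rep_div1 hQ y, hφ y] at h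
    simp only [map_mul, map_sub, map_pow, map_add, map_zero, ev_algebraMap, h6]
    field_simp at h
    linear_combination h / 8
  refine ⟨fun ν => ?_, ?_⟩
  · rw [hG.rep_div2 hX ν ⟨x, hx⟩]
    have h := congrArg (ev ⟨x, hx⟩) (LeviCivita.mul_div2_fieldTensor _ (hc _) (hc _) (hc _) (hc _)
      hh2 hP' hS' ν)
    -- The extra factor φ of `mul_div2_fieldTensor` is cancelled after evaluation, where φ(x) is a
    -- nonzero real number.
    rw [map_mul, map_zero, ← hφ] at h
    exact (mul_eq_zero.mp h).resolve_left (hφ0 x hx)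
  · rw [hG.rep_trace hX ⟨x, hx⟩, LeviCivita.tr2_fieldTensor _ (by simp) (hc _) (hc _) hh2 hP' hS',
      map_zero]

end IsMetricOn

end

/-! ### From charts to the manifold: trace and divergence of the matter tensor. -/

section

open TopologicalSpace SmoothFun Matrix IsManifold

section Chart

variable {M : Type*} [TopologicalSpace M] [ChartedSpace E4 M] {e : OpenPartialHomeomorph M E4}

lemma mdifferentiable_of_mem_maximalAtlas [IsManifold (𝓡 4) ∞ M]
    (he : e ∈ maximalAtlas (𝓡 4) ∞ M) : e.MDifferentiable (𝓡 4) (𝓡 4) :=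
  ⟨(contMDiffOn_of_mem_maximalAtlas he).mdifferentiableOn (by simp),
    (contMDiffOn_symm_of_mem_maximalAtlas he).mdifferentiableOn (by simp)⟩

lemma sum_smul_single (a : E4) : ∑ μ, a μ • EuclideanSpace.single μ (1 : ℝ) = a := by
  ext i
  simp [Finset.sum_apply, Pi.single_apply]

/-- A vector of the tangent space in terms of the coordinate vectors. -/
lemma mfderiv_symm_eq_sum (x a : E4) :
    mfderiv (𝓡 4) (𝓡 4) e.symm x a = ∑ μ, a μ • coordVec e μ x := by
  let A : E4 →L[ℝ] TangentSpace (𝓡 4) (e.symm x) := mfderiv (𝓡 4) (𝓡 4) e.symm x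
  change A a = ∑ μ, a μ • A (EuclideanSpace.single μ (1 : ℝ))
  conv_lhs => rw [← sum_smul_single a]
  rw [map_sum]
  exact Finset.sum_congr rfl fun μ _ => map_smul _ _ _

lemma bilin_mfderiv_symm (B : BilinField M) (x a b : E4) :
    B (e.symm x) (mfderiv (𝓡 4) (𝓡 4) e.symm x a) (mfderiv (𝓡 4) (𝓡 4) e.symm x b)
      = ∑ μ, ∑ ν, bilinComp e B x μ ν * a μ * b ν := by
  rw [mfderiv_symm_eq_sum, mfderiv_symm_eq_sum]
  simp only [map_sum, map_smul, _root_.sum_apply, _root_.smul_apply,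
    smul_eq_mul, Finset.mul_sum, bilinComp, Matrix.of_apply]
  rw [Finset.sum_comm]
  exact Finset.sum_congr rfl fun _ _ => Finset.sum_congr rfl fun _ _ => by ring

end Chart

namespace WeylSpace

variable {M : Type*} [TopologicalSpace M] [ChartedSpace E4 M] (S : WeylSpace M)
  {e : OpenPartialHomeomorph M E4}

lemma g_symm (p : M) (u v : TangentSpace (𝓡 4) p) : S.g p u v = S.g p v u := by
  obtain ⟨b, hb⟩ := S.lorentzian p
  rw [← b.sum_repr u, ← b.sum_repr v]
  simp only [map_sum, map_smul, _root_.sum_apply, _root_.smul_apply,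
    smul_eq_mul, hb, mul_ite, mul_zero, Finset.sum_ite_eq', Finset.mem_univ]
  exact Finset.sum_congr rfl fun i _ => by split_ifs <;> ring

lemma g_nondegenerate (p : M) {v : TangentSpace (𝓡 4) p} (h : ∀ u, S.g p u v = 0) : v = 0 := by
  obtain ⟨b, hb⟩ := S.lorentzian p
  rw [← b.sum_repr v]
  refine Finset.sum_eq_zero fun i _ => ?_
  have h2 := h (b i)
  rw [← b.sum_repr v] at h2
  simp only [map_sum, map_smul, smul_eq_mul, hb, mul_ite, mul_zero, Finset.sum_ite_eq,
    Finset.mem_univ] at h2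
  have h3 : b.repr v i = 0 := by
    simp at h2
    split_ifs at h2 <;> simpa using h2
  rw [h3, zero_smul]

variable [IsManifold (𝓡 4) ∞ M]

lemma isMetricOn (he : e ∈ maximalAtlas (𝓡 4) ∞ M) :
    IsMetricOn ⟨e.target, e.open_target⟩ (bilinComp e S.g) where
  smooth := S.smooth_g e he
  symm x _ μ ν := S.g_symm _ _ _
  det_ne_zero x hx h := by
    have hx' : x ∈ e.target := hx
    -- A kernel vector of the component matrix is the coordinate vector of a tangent vector
    -- orthogonal to everything; it vanishes because the chart differential is bijective and the
    -- metric is nondegenerate.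
    obtain ⟨v, hv, hv0⟩ := Matrix.exists_mulVec_eq_zero_iff.mpr h
    have hA := (mdifferentiable_of_mem_maximalAtlas he).symm.mfderiv_bijective hx'
    have hzero : mfderiv (𝓡 4) (𝓡 4) e.symm x (WithLp.toLp 2 v : E4) = 0 := by
      refine S.g_nondegenerate _ fun u => ?_
      obtain ⟨a, rfl⟩ := hA.2 u
      refine (bilin_mfderiv_symm S.g x (a : E4) _).trans ?_
      refine Finset.sum_eq_zero fun μ _ => ?_
      have h2 := congrFun hv0 μ
      simp only [Matrix.mulVec, dotProduct, Pi.zero_apply] at h2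
      calc _ = (show E4 from a) μ * ∑ ν, bilinComp e S.g x μ ν * v ν := by
            rw [Finset.mul_sum]; exact Finset.sum_congr rfl fun _ _ => by dsimp only; ring
        _ = 0 := by rw [h2, mul_zero]
    have h2 := hA.1 (hzero.trans (map_zero _).symm)
    exact hv (congrArg (WithLp.ofLp) h2)

variable {om β lam : ℝ} {φ : M → ℝ}

omit [IsManifold (𝓡 4) ∞ M] in
lemma contDiffOn_funComp (hφ : ContMDiff (𝓡 4) 𝓘(ℝ) ∞ φ) (he : e ∈ maximalAtlas (𝓡 4) ∞ M) :
    ContDiffOn ℝ ∞ (funComp e φ) e.target :=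
  contMDiffOn_iff_contDiffOn.mp
    (hφ.comp_contMDiffOn (contMDiffOn_symm_of_mem_maximalAtlas he))

lemma calETotal_conserved (hβ : β ≠ 0) (hφ : ContMDiff (𝓡 4) 𝓘(ℝ) ∞ φ) (hφ0 : ∀ p, φ p ≠ 0)
    (hP : S.Proca om β φ) (hS : S.ScalarEq om lam φ) (he : e ∈ maximalAtlas (𝓡 4) ∞ M)
    {x : E4} (hx : x ∈ e.target) :
    (∀ ν, Coord.div2 (bilinComp e S.g)
      (Coord.calETotal om β lam (bilinComp e S.g) (covComp e S.Q) (funComp e φ)) ν x = 0) ∧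
    Coord.trace (bilinComp e S.g)
      (Coord.calETotal om β lam (bilinComp e S.g) (covComp e S.Q) (funComp e φ)) x = 0 :=
  (S.isMetricOn he).calETotal_conserved (Q' := fun μ => res _ (S.smooth_Q e he μ))
    (φ' := res _ (contDiffOn_funComp hφ he)) (fun _ _ => hφ0 _) hβ (fun _ => rep_res _ _)
    (rep_res _ _) (hP e he) (hS e he) hx

omit [IsManifold (𝓡 4) ∞ M] in
lemma EinsteinEq.eq_calETotal {T : BilinField M} (hφ0 : ∀ p, φ p ≠ 0)
    (hT : S.EinsteinEq om β lam φ T) (he : e ∈ maximalAtlas (𝓡 4) ∞ M) {x : E4}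
    (hx : x ∈ e.target) : bilinComp e T x
      = Coord.calETotal om β lam (bilinComp e S.g) (covComp e S.Q) (funComp e φ) x := by
  ext μ ν
  have h0 : funComp e φ x ≠ 0 := hφ0 _
  simp only [Coord.calETotal, Matrix.add_apply, Matrix.smul_apply, smul_eq_mul, hT e he x hx μ ν]
  field_simp
  ring

lemma div2_congr {G X Y : E4 → Matrix (Fin 4) (Fin 4) ℝ} {U : Opens E4}
    (h : ∀ y ∈ U, X y = Y y) {x : E4} (hx : x ∈ U) (ν : Fin 4) :
    Coord.div2 G X ν x = Coord.div2 G Y ν x := by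
  have h2 : ∀ α μ ν, Coord.pd α (fun y => X y μ ν) x = Coord.pd α (fun y => Y y μ ν) x :=
    fun α μ ν => SmoothFun.pd_congr (fun y hy => by rw [h y hy]) α hx
  simp only [Coord.div2, Coord.nabla2, h x hx, h2]

variable {T : BilinField M}

lemma traceless (hβ : β ≠ 0) (hφ : ContMDiff (𝓡 4) 𝓘(ℝ) ∞ φ) (hφ0 : ∀ p, φ p ≠ 0)
    (hP : S.Proca om β φ) (hS : S.ScalarEq om lam φ) (hT : S.EinsteinEq om β lam φ T) :
    S.Traceless T := fun e he x hx => by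
  rw [← (S.calETotal_conserved hβ hφ hφ0 hP hS he hx).2, Coord.trace, Coord.trace,
    EinsteinEq.eq_calETotal S hφ0 hT he hx]

lemma conserved (hβ : β ≠ 0) (hφ : ContMDiff (𝓡 4) 𝓘(ℝ) ∞ φ) (hφ0 : ∀ p, φ p ≠ 0)
    (hP : S.Proca om β φ) (hS : S.ScalarEq om lam φ) (hT : S.EinsteinEq om β lam φ T) :
    S.Conserved T := fun e he x hx ν => by
  rw [← (S.calETotal_conserved hβ hφ hφ0 hP hS he hx).1 ν]
  exact div2_congr (U := ⟨e.target, e.open_target⟩)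
    (fun y hy => EinsteinEq.eq_calETotal S hφ0 hT he hy) hx ν

end WeylSpace

end

/-! ### Change of charts for covectors, vectors and exterior derivatives. -/

section

open TopologicalSpace SmoothFun Matrix IsManifold Topology

section Chart

variable {M : Type*} [TopologicalSpace M] [ChartedSpace E4 M] {e e' : OpenPartialHomeomorph M E4}

/-- A covector field in the chart `e`. -/
def covForm (e : OpenPartialHomeomorph M E4) (w : CovectorField M) (x : E4) : E4 →L[ℝ] ℝ :=
  (w (e.symm x)).comp (mfderiv (𝓡 4) (𝓡 4) e.symm x)

lemma covForm_single (w : CovectorField M) (x : E4) (μ : Fin 4) :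
    covForm e w x (EuclideanSpace.single μ 1) = covComp e w x μ := rfl

lemma covForm_apply (w : CovectorField M) (x a : E4) :
    covForm e w x a = ∑ μ, a μ * covComp e w x μ := by
  conv_lhs => rw [← sum_smul_single a]
  simp [covForm_single]

lemma covForm_eq_sum (w : CovectorField M) (x : E4) :
    covForm e w x = ∑ μ, covComp e w x μ • (EuclideanSpace.proj μ : E4 →L[ℝ] ℝ) := by
  ext a
  simp [covForm_apply, mul_comm]

/-- The exterior derivative of a covector field in the chart `e`. -/
def extForm (e : OpenPartialHomeomorph M E4) (w : CovectorField M) (x u v : E4) : ℝ :=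
  fderiv ℝ (covForm e w) x u v - fderiv ℝ (covForm e w) x v u

lemma differentiableAt_covForm {w : CovectorField M} {x : E4}
    (hw : ∀ μ, DifferentiableAt ℝ (fun y => covComp e w y μ) x) :
    DifferentiableAt ℝ (covForm e w) x := by
  rw [show covForm e w = fun y => _ from funext (covForm_eq_sum w)]
  exact DifferentiableAt.fun_sum fun μ _ => (hw μ).smul_const _

lemma extForm_apply {w : CovectorField M} {x : E4}
    (hw : ∀ μ, DifferentiableAt ℝ (fun y => covComp e w y μ) x) (u v : E4) :
    extForm e w x u v = ∑ ν, v ν * ∑ α, u α * (Coord.pd α (fun y => covComp e w y ν) x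
      - Coord.pd ν (fun y => covComp e w y α) x) := by
  have h : ∀ u v : E4, fderiv ℝ (covForm e w) x u v
      = ∑ ν, ∑ α, v ν * u α * Coord.pd α (fun y => covComp e w y ν) x := fun u v => by
    have h2 : ∀ a : E4, (fun y => covForm e w y a) = fun y => ∑ μ, a μ * covComp e w y μ :=
      fun a => funext fun y => covForm_apply w y a
    have h3 : fderiv ℝ (covForm e w) x u v = fderiv ℝ (fun y => covForm e w y v) x u := by
      rw [fderiv_clm_apply (differentiableAt_covForm hw) (differentiableAt_const _)]
      simp
    rw [h3, h2, fderiv_fun_sum fun μ _ => (hw μ).const_mul _]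
    simp only [fderiv_const_mul (hw _), _root_.sum_apply, _root_.smul_apply, smul_eq_mul]
    refine Finset.sum_congr rfl fun ν _ => ?_
    simp only [mul_assoc, ← Finset.mul_sum]
    congr 1
    conv_lhs => rw [← sum_smul_single u]
    rw [map_sum]
    simp [Coord.pd]
  have h2 := h v u
  rw [Finset.sum_comm] at h2
  rw [extForm, h u v, h2, ← Finset.sum_sub_distrib]
  refine Finset.sum_congr rfl fun ν _ => ?_
  rw [← Finset.sum_sub_distrib, Finset.mul_sum]
  exact Finset.sum_congr rfl fun α _ => by ring

/-- The points `e.symm (e p)` and `p` are only propositionally equal, so the fibres over them must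
be compared by generalizing the base point. -/
lemma vecComp_apply (k : VecField M) {p : M} (hp : p ∈ e.source) :
    vecComp e k (e p) = mfderiv (𝓡 4) (𝓡 4) e p (k p) := by
  have h : ∀ q, q = p → (mfderiv (𝓡 4) (𝓡 4) e q (k q) : E4) = mfderiv (𝓡 4) (𝓡 4) e p (k p) := by
    rintro _ rfl; rfl
  exact h _ (e.left_inv hp)

variable [IsManifold (𝓡 4) ∞ M]

lemma mfderiv_symm_vecComp (he : e ∈ maximalAtlas (𝓡 4) ∞ M) (k : VecField M) {x : E4}
    (hx : x ∈ e.target) : mfderiv (𝓡 4) (𝓡 4) e.symm x (vecComp e k x) = k (e.symm x) := by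
  have h := (mdifferentiable_of_mem_maximalAtlas he).symm_comp_deriv (e.map_target hx)
  have h2 := congrArg (fun A => A (k (e.symm x))) h
  rw [e.right_inv hx] at h2
  exact h2

/-- The transition map between two charts. -/
def transition (e' e : OpenPartialHomeomorph M E4) (x : E4) : E4 := e (e'.symm x)

omit [IsManifold (𝓡 4) ∞ M] in
lemma contDiffAt_transition (he : e ∈ maximalAtlas (𝓡 4) ∞ M) (he' : e' ∈ maximalAtlas (𝓡 4) ∞ M)
    {x : E4} (hx : x ∈ e'.target) (hx' : e'.symm x ∈ e.source) :
    ContDiffAt ℝ ∞ (transition e' e) x := by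
  rw [← contMDiffAt_iff_contDiffAt]
  exact (contMDiffAt_of_mem_maximalAtlas he hx').comp x
    (contMDiffAt_symm_of_mem_maximalAtlas he' hx)

lemma covForm_transition (he : e ∈ maximalAtlas (𝓡 4) ∞ M)
    (he' : e' ∈ maximalAtlas (𝓡 4) ∞ M)
    {x : E4} (hx : x ∈ e'.target) (hx' : e'.symm x ∈ e.source) (w : CovectorField M) :
    covForm e' w x = (covForm e w (transition e' e x)).comp (fderiv ℝ (transition e' e) x) := by
  set τ := transition e' e
  have hτ : ContDiffAt ℝ ∞ τ x := contDiffAt_transition he he' hx hx'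
  have hpt : e.symm (τ x) = e'.symm x := e.left_inv hx'
  have hτx : τ x ∈ e.target := e.map_source hx'
  have h : e'.symm =ᶠ[𝓝 x] e.symm ∘ τ := by
    filter_upwards [(e'.continuousAt_symm hx).eventually_mem (e.open_source.mem_nhds hx')]
      with y hy using (e.left_inv hy).symm
  have h2 : mfderiv (𝓡 4) (𝓡 4) (e.symm ∘ τ) x
      = (mfderiv (𝓡 4) (𝓡 4) e.symm (τ x)).comp (mfderiv (𝓡 4) (𝓡 4) τ x) :=
    mfderiv_comp x ((mdifferentiable_of_mem_maximalAtlas he).mdifferentiableAt_symm hτx)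
      (hτ.differentiableAt (by simp)).mdifferentiableAt
  have h3 : mfderiv (𝓡 4) (𝓡 4) τ x = fderiv ℝ τ x := mfderiv_eq_fderiv
  have hw : ∀ p q : M, p = q → ∀ a : E4, w p a = w q a := by
    rintro p _ rfl a; rfl
  ext a
  refine (hw _ _ hpt.symm _).trans (congrArg (fun b : E4 => w (e.symm (τ x)) b) ?_)
  refine (congrArg (fun A : E4 →L[ℝ] E4 => A a) h.mfderiv_eq).trans ?_
  refine (congrArg (fun A : E4 →L[ℝ] E4 => A a) h2).trans ?_
  exact congrArg (fun A : E4 →L[ℝ] E4 => mfderiv (𝓡 4) (𝓡 4) e.symm (τ x) (A a)) h3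

lemma vecComp_transition (he : e ∈ maximalAtlas (𝓡 4) ∞ M) (he' : e' ∈ maximalAtlas (𝓡 4) ∞ M)
    {x : E4} (hx : x ∈ e'.target) (hx' : e'.symm x ∈ e.source) (k : VecField M) :
    vecComp e k (transition e' e x) = fderiv ℝ (transition e' e) x (vecComp e' k x) := by
  have h : fderiv ℝ (transition e' e) x = (mfderiv (𝓡 4) (𝓡 4) e (e'.symm x)).comp
      (mfderiv (𝓡 4) (𝓡 4) e'.symm x) := by
    refine mfderiv_eq_fderiv.symm.trans ?_
    exact mfderiv_comp x ((mdifferentiable_of_mem_maximalAtlas he).mdifferentiableAt hx')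
      ((mdifferentiable_of_mem_maximalAtlas he').mdifferentiableAt_symm hx)
  rw [h]
  refine (vecComp_apply k hx').trans ?_
  rw [← mfderiv_symm_vecComp he' k hx]
  rfl

/-- The exterior derivative commutes with pullback: the second derivative of the transition map is
symmetric and drops out of the antisymmetrization. -/
lemma extForm_transition (he : e ∈ maximalAtlas (𝓡 4) ∞ M) (he' : e' ∈ maximalAtlas (𝓡 4) ∞ M)
    {x : E4} (hx : x ∈ e'.target) (hx' : e'.symm x ∈ e.source) {w : CovectorField M}
    (hw : DifferentiableAt ℝ (covForm e w) (transition e' e x)) (u v : E4) :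
    extForm e' w x u v = extForm e w (transition e' e x) (fderiv ℝ (transition e' e) x u)
      (fderiv ℝ (transition e' e) x v) := by
  set τ := transition e' e
  have hτ : ContDiffAt ℝ ∞ τ x := contDiffAt_transition he he' hx hx'
  have hdτ : DifferentiableAt ℝ (fderiv ℝ τ) x :=
    (hτ.fderiv_right (m := 1) (WithTop.coe_le_coe.2 (le_top : (2 : ℕ∞) ≤ ⊤))).differentiableAt
      (by simp)
  have h : covForm e' w =ᶠ[𝓝 x] fun y => (covForm e w (τ y)).comp (fderiv ℝ τ y) := by
    have h1 : ∀ᶠ y in 𝓝 x, y ∈ e'.target := e'.open_target.mem_nhds hx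
    have h2 : ∀ᶠ y in 𝓝 x, e'.symm y ∈ e.source :=
      (e'.continuousAt_symm hx).eventually_mem (e.open_source.mem_nhds hx')
    filter_upwards [h1, h2] with y hy hy'
    exact covForm_transition he he' hy hy' w
  have hd : DifferentiableAt ℝ (fun y => covForm e w (τ y)) x :=
    hw.comp x (hτ.differentiableAt (by simp))
  have hder : fderiv ℝ (fun y => covForm e w (τ y)) x
      = (fderiv ℝ (covForm e w) (τ x)).comp (fderiv ℝ τ x) :=
    fderiv_fun_comp x hw (hτ.differentiableAt (by simp))
  have hsymm := hτ.isSymmSndFDerivAt (by simpa using WithTop.coe_le_coe.2 (le_top : (2 : ℕ∞) ≤ ⊤))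
  have hfd : ∀ u v, fderiv ℝ (covForm e' w) x u v
      = fderiv ℝ (covForm e w) (τ x) (fderiv ℝ τ x u) (fderiv ℝ τ x v)
        + covForm e w (τ x) (fderiv ℝ (fderiv ℝ τ) x u v) := fun u v => by
    rw [h.fderiv_eq, fderiv_clm_comp hd hdτ, hder]
    simp [add_comm]
  rw [extForm, extForm, hfd, hfd, hsymm u v]
  ring

end Chart

end

/-! ### Affine reparametrization. -/

section

open Set Topology

lemma hasDerivAt_integral_of_continuousOn {I : Set ℝ} {f : ℝ → ℝ} (hI : IsOpen I)
    (hI' : I.OrdConnected) (hf : ContinuousOn f I) {a t : ℝ} (ha : a ∈ I) (ht : t ∈ I) :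
    HasDerivAt (fun t => ∫ x in a..t, f x) (f t) t :=
  intervalIntegral.integral_hasDerivAt_right
    ((hf.mono (hI'.uIcc_subset ha ht)).intervalIntegrable)
    (hf.stronglyMeasurableAtFilter hI t ht) (hf.continuousAt (hI.mem_nhds ht))

/-- The change of parameter that turns a curve with acceleration `f` times the velocity into an
affinely parametrized one. -/
lemma exists_affine_parameter {I : Set ℝ} {f : ℝ → ℝ} (hI : IsOpen I) (hI' : I.OrdConnected)
    (hf : ContinuousOn f I) :
    ∃ (J : Set ℝ) (σ q : ℝ → ℝ), IsOpen J ∧ J.OrdConnected ∧ BijOn σ J I ∧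
      (∀ s ∈ J, 0 < q s) ∧ (∀ s ∈ J, HasDerivAt σ (q s) s) ∧
      ∀ s ∈ J, HasDerivAt q (-f (σ s) * q s ^ 2) s := by
  rcases I.eq_empty_or_nonempty with rfl | ⟨a, ha⟩
  · exact ⟨∅, id, fun _ => 1, isOpen_empty, ordConnected_empty, bijOn_empty _, by simp, by simp,
      by simp⟩
  -- The inverse `A` of the desired σ must satisfy A'' = f A'. Hence A' = exp ∫f = `h`, A = ∫h, and
  -- σ' = 1/h(σ) has derivative -f(σ)σ'².
  set h : ℝ → ℝ := fun t => Real.exp (∫ x in a..t, f x) with hh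
  have hder : ∀ t ∈ I, HasDerivAt h (h t * f t) t := fun t ht =>
    (hasDerivAt_integral_of_continuousOn hI hI' hf ha ht).exp
  have hpos : ∀ t, 0 < h t := fun t => Real.exp_pos _
  have hcont : ContinuousOn h I := fun t ht => (hder t ht).continuousAt.continuousWithinAt
  set A : ℝ → ℝ := fun t => ∫ x in a..t, h x with hA
  have hAder : ∀ t ∈ I, HasDerivAt A (h t) t := fun t ht =>
    hasDerivAt_integral_of_continuousOn hI hI' hcont ha ht
  have hAcont : ContinuousOn A I := fun t ht => (hAder t ht).continuousAt.continuousWithinAt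
  have hmono : StrictMonoOn A I := by
    refine strictMonoOn_of_deriv_pos hI'.convex hAcont fun t ht => ?_
    rw [(hAder t (interior_subset ht)).deriv]
    exact hpos t
  -- A nonzero strict derivative makes `A` an open map near each point of `I`.
  have hJ : IsOpen (A '' I) := by
    rw [isOpen_iff_mem_nhds]
    rintro _ ⟨t, ht, rfl⟩
    have hs : HasStrictDerivAt A (h t) t :=
      hasStrictDerivAt_of_hasDerivAt_of_continuousAt
        (Filter.eventually_of_mem (hI.mem_nhds ht) hAder) (hcont.continuousAt (hI.mem_nhds ht))
    rw [← hs.map_nhds_eq (hpos t).ne']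
    exact Filter.image_mem_map (hI.mem_nhds ht)
  set σ : ℝ → ℝ := Function.invFunOn A I with hσ
  have hinv : InvOn σ A I (A '' I) := hmono.injOn.bijOn_image.invOn_invFunOn
  have hbij : BijOn σ (A '' I) I := hmono.injOn.bijOn_image.symm hinv.symm
  have hσmono : StrictMonoOn σ (A '' I) := by
    intro s hs s' hs' hss
    rw [← hmono.lt_iff_lt (hbij.mapsTo hs) (hbij.mapsTo hs'), hinv.2 hs, hinv.2 hs']
    exact hss
  have hσcont : ∀ s ∈ A '' I, ContinuousAt σ s := fun s hs =>
    hσmono.continuousAt_of_image_mem_nhds (hJ.mem_nhds hs)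
      (by rw [hbij.image_eq]; exact hI.mem_nhds (hbij.mapsTo hs))
  have hσder : ∀ s ∈ A '' I, HasDerivAt σ (h (σ s))⁻¹ s := fun s hs =>
    (hAder _ (hbij.mapsTo hs)).of_local_left_inverse (hσcont s hs) (hpos _).ne'
      (Filter.eventually_of_mem (hJ.mem_nhds hs) fun y hy => hinv.2 hy)
  refine ⟨A '' I, σ, fun s => (h (σ s))⁻¹, hJ, ?_, hbij, fun s _ => inv_pos.mpr (hpos _), hσder,
    fun s hs => ?_⟩
  · exact (hI'.isPreconnected.image A hAcont).ordConnected
  · have h1 := ((hder _ (hbij.mapsTo hs)).comp s (hσder s hs)).inv (hpos _).ne'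
    have h2 := (hpos (σ s)).ne'
    have h3 : -f (σ s) * (h (σ s))⁻¹ ^ 2 = -(h (σ s) * f (σ s) * (h (σ s))⁻¹) / h (σ s) ^ 2 := by
      field_simp
    rw [h3]
    exact h1

end

/-! ### Acceleration of a stream as a function on the manifold. -/

section

open TopologicalSpace SmoothFun Matrix IsManifold Topology Set

lemma IsMetricOn.mono {U V : Opens E4} {G : E4 → Matrix (Fin 4) (Fin 4) ℝ} (hG : IsMetricOn U G)
    (h : (V : Set E4) ⊆ U) : IsMetricOn V G :=
  ⟨fun μ ν => (hG.smooth μ ν).mono h, fun x hx => hG.symm x (h hx),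
    fun x hx => hG.det_ne_zero x (h hx)⟩

lemma contDiffOn_succ_of_hasDerivAt {E : Type*} [NormedAddCommGroup E] [NormedSpace ℝ E]
    {N : Set ℝ} (hN : IsOpen N) {γ γ' : ℝ → E} {n : ℕ} (h : ∀ s ∈ N, HasDerivAt γ (γ' s) s)
    (h' : ContDiffOn ℝ n γ' N) : ContDiffOn ℝ (n + 1) γ N := by
  rw [contDiffOn_succ_iff_deriv_of_isOpen hN]
  exact ⟨fun s hs => (h s hs).differentiableAt.differentiableWithinAt, by simp,
    h'.congr fun s hs => (h s hs).deriv⟩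

namespace WeylSpace

variable {M : Type*} [TopologicalSpace M] [ChartedSpace E4 M] (S : WeylSpace M)

/-- The metric dual of a vector field. -/
def flat (k : VecField M) : CovectorField M := fun p => S.g p (k p)

variable {S} {e e' : OpenPartialHomeomorph M E4} {T : BilinField M} {W : Set M} {ρ : M → ℝ}
  {k : VecField M}

lemma flat_ne_zero {p : M} (hp : k p ≠ 0) : S.flat k p ≠ 0 := fun h => by
  refine hp (S.g_nondegenerate p fun u => ?_)
  rw [S.g_symm]
  exact congrArg (fun A : TangentSpace (𝓡 4) p →L[ℝ] ℝ => A u) h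

lemma IsStream.ne_zero (h : S.IsStream T W ρ k) {p : M} (hp : p ∈ W) (hT : T p ≠ 0) :
    ρ p ≠ 0 ∧ k p ≠ 0 := by
  constructor
  · intro h0
    refine hT ?_
    ext u v
    rw [h.eq p hp, h0]
    simp
  · intro h0
    refine hT ?_
    ext u v
    rw [h.eq p hp, h0]
    simp

lemma IsStream.isOpen_support (h : S.IsStream T W ρ k) : IsOpen {p | p ∈ W ∧ ρ p ≠ 0} :=
  h.smooth_rho.continuousOn.isOpen_inter_preimage h.isOpen isOpen_compl_singleton

variable [IsManifold (𝓡 4) ∞ M]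

lemma covComp_flat (he : e ∈ maximalAtlas (𝓡 4) ∞ M) {x : E4} (hx : x ∈ e.target) (μ : Fin 4) :
    covComp e (S.flat k) x μ = ∑ ν, bilinComp e S.g x μ ν * vecComp e k x ν := by
  have h2 := bilin_mfderiv_symm (e := e) S.g x (EuclideanSpace.single μ 1 : E4) (vecComp e k x)
  rw [mfderiv_symm_vecComp he k hx, S.g_symm] at h2
  refine h2.trans ?_
  simp

/-- In a chart, the streamlines of a traceless and conserved stream are null, and their acceleration
is proportional to their velocity. -/
lemma IsStream.exists_factor (h : S.IsStream T W ρ k) (htr : S.Traceless T)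
    (hcons : S.Conserved T) (he : e ∈ maximalAtlas (𝓡 4) ∞ M) :
    ∃ f : E4 → ℝ, ContinuousOn f (e.target ∩ e.symm ⁻¹' {p | p ∈ W ∧ ρ p ≠ 0}) ∧
      ∀ x ∈ e.target ∩ e.symm ⁻¹' {p | p ∈ W ∧ ρ p ≠ 0},
        (∀ μ, DifferentiableAt ℝ (fun y => covComp e (S.flat k) y μ) x) ∧
        (∀ v, extForm e (S.flat k) x (vecComp e k x) v = f x * covForm e (S.flat k) x v) ∧
        (∑ μ, ∑ ν, bilinComp e S.g x μ ν * vecComp e k x μ * vecComp e k x ν = 0) ∧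
        ∀ β, ∑ α, vecComp e k x α * Coord.pd α (fun y => vecComp e k y β) x
          + ∑ α, ∑ γ, Coord.christoffel (bilinComp e S.g) β α γ x
            * vecComp e k x α * vecComp e k x γ = f x * vecComp e k x β := by
  -- On this open set ρ is a unit of the ring of smooth functions, as `stream` requires.
  set V := e.target ∩ e.symm ⁻¹' {p | p ∈ W ∧ ρ p ≠ 0} with hV
  have hVo : IsOpen V := e.isOpen_inter_preimage_symm h.isOpen_support
  let U : Opens E4 := ⟨V, hVo⟩
  have hG : IsMetricOn U (bilinComp e S.g) := (S.isMetricOn he).mono inter_subset_left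
  have hVW : V ⊆ e.target ∩ e.symm ⁻¹' W := fun x hx => ⟨hx.1, hx.2.1⟩
  have hρ : ContDiffOn ℝ ∞ (fun x => ρ (e.symm x)) U :=
    contMDiffOn_iff_contDiffOn.mp (h.smooth_rho.comp
      ((contMDiffOn_symm_of_mem_maximalAtlas he).mono inter_subset_left) fun x hx => hx.2.1)
  have hk : ∀ μ, ContDiffOn ℝ ∞ (fun x => vecComp e k x μ) U := fun μ =>
    contDiffOn_euclidean.mp ((h.smooth_k e he).mono hVW) μ
  set v : Fin 4 → SmoothFun U := fun μ => res _ (hk μ) with hv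
  have hrv : ∀ μ, Rep (fun x => vecComp e k x μ) (v μ) := fun μ => rep_res _ (hk μ)
  have hrw : RepV (covComp e (S.flat k)) (hG.lc.g *ᵥ v) := fun μ y => by
    simp only [covComp_flat he y.2.1, Matrix.mulVec, dotProduct, map_sum, map_mul,
      hG.rep_g _ _ y, hrv _ y]
  have hrT : RepM (bilinComp e T) (res _ hρ • LeviCivita.outer (hG.lc.g *ᵥ v) (hG.lc.g *ᵥ v)) :=
    fun μ ν y => by
      simp only [LeviCivita.outer, Matrix.smul_apply, Matrix.of_apply, smul_eq_mul, map_mul,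
        ← hrw _ y, ← rep_res _ hρ y, ← mul_assoc]
      exact h.eq _ y.2.2.1 _ _
  obtain ⟨ρ', hρ'⟩ := (isUnit_of_ev_ne_zero (f := res _ hρ)
    fun y => by rw [← rep_res _ hρ y]; exact y.2.2.2).exists_right_inv
  obtain ⟨hnull, f, hf, hgeo⟩ := hG.lc.stream hρ' v
    (ext_ev fun y => by rw [← hG.rep_trace hrT, htr e he y y.2.1, map_zero])
    (fun ν => ext_ev fun y => by rw [← hG.rep_div2 hrT, hcons e he y y.2.1, map_zero])
  obtain ⟨F, hF⟩ := exists_rep f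
  refine ⟨F, hF.contDiffOn.continuousOn, fun x hx => ⟨fun μ => ?_, fun u => ?_, ?_, fun β => ?_⟩⟩
  · exact (hrw μ).differentiableAt ⟨x, hx⟩
  · rw [extForm_apply fun μ => (hrw μ).differentiableAt ⟨x, hx⟩, covForm_apply, Finset.mul_sum]
    refine Finset.sum_congr rfl fun ν _ => ?_
    have h2 := congrArg (ev ⟨x, hx⟩) (hf ν)
    simp only [map_sum, map_mul, ← hG.rep_fieldStrength hrw _ _ ⟨x, hx⟩, ← hrw ν ⟨x, hx⟩,
      ← hF ⟨x, hx⟩, ← hrv _ ⟨x, hx⟩] at h2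
    have h3 : ∑ α, vecComp e k x α * (Coord.pd α (fun y => covComp e (S.flat k) y ν) x
      - Coord.pd ν (fun y => covComp e (S.flat k) y α) x) = F x * covComp e (S.flat k) x ν := h2
    rw [h3]
    ring
  · have h2 := congrArg (ev ⟨x, hx⟩) hnull
    simpa only [map_sum, map_mul, map_zero, ← hG.rep_g _ _ ⟨x, hx⟩, ← hrv _ ⟨x, hx⟩] using h2
  · have h2 := congrArg (ev ⟨x, hx⟩) (hgeo β)
    simp only [map_sum, map_mul, map_add, ← hG.rep_christoffel _ _ _ ⟨x, hx⟩, ← hrv _ ⟨x, hx⟩,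
      ← hF ⟨x, hx⟩] at h2
    rw [← h2]
    congr 1
    exact Finset.sum_congr rfl fun α _ => by rw [(hrv β).pd α ⟨x, hx⟩]; rfl

/-- The factor of proportionality is a function on the manifold. -/
lemma IsStream.exists_acceleration (h : S.IsStream T W ρ k) (htr : S.Traceless T)
    (hcons : S.Conserved T) :
    ∃ F : M → ℝ, ∀ e ∈ maximalAtlas (𝓡 4) ∞ M,
      ContinuousOn F {p | p ∈ e.source ∧ p ∈ W ∧ T p ≠ 0} ∧
      ∀ x ∈ e.target, e.symm x ∈ W → T (e.symm x) ≠ 0 →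
        (∑ μ, ∑ ν, bilinComp e S.g x μ ν * vecComp e k x μ * vecComp e k x ν = 0) ∧
        ∀ β, ∑ α, vecComp e k x α * Coord.pd α (fun y => vecComp e k y β) x
          + ∑ α, ∑ γ, Coord.christoffel (bilinComp e S.g) β α γ x
            * vecComp e k x α * vecComp e k x γ = F (e.symm x) * vecComp e k x β := by
  choose f hfc hf using fun (e : OpenPartialHomeomorph M E4)
    (he : e ∈ maximalAtlas (𝓡 4) ∞ M) => h.exists_factor htr hcons he
  have hchart : ∀ p : M, chartAt E4 p ∈ maximalAtlas (𝓡 4) ∞ M := fun p =>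
    chart_mem_maximalAtlas p
  -- Both sides of ι_k dk♭ = f k♭ are natural under transition maps. Evaluating on a vector with
  -- k♭(v) ≠ 0, which exists because k ≠ 0 where T ≠ 0, shows that the two factors agree.
  have key : ∀ e (he : e ∈ maximalAtlas (𝓡 4) ∞ M) e' (he' : e' ∈ maximalAtlas (𝓡 4) ∞ M) p,
      p ∈ e.source → p ∈ e'.source → p ∈ W → T p ≠ 0 → f e he (e p) = f e' he' (e' p) := by
    intro e he e' he' p hp hp' hpW hTp
    obtain ⟨hρ0, hk0⟩ := h.ne_zero hpW hTp
    have hx : e' p ∈ e'.target := e'.map_source hp'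
    have hsymm : e'.symm (e' p) = p := e'.left_inv hp'
    have hx' : e'.symm (e' p) ∈ e.source := hsymm.symm ▸ hp
    have hτ : transition e' e (e' p) = e p := congrArg e hsymm
    have hmem : ∀ {e : OpenPartialHomeomorph M E4}, p ∈ e.source →
        e p ∈ e.target ∩ e.symm ⁻¹' {p | p ∈ W ∧ ρ p ≠ 0} := fun {e} hp =>
      ⟨e.map_source hp, by rw [mem_preimage, e.left_inv hp]; exact ⟨hpW, hρ0⟩⟩
    obtain ⟨hd, h1, -⟩ := hf e he (e p) (hmem hp)
    obtain ⟨-, h2, -⟩ := hf e' he' (e' p) (hmem hp')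
    have hcov := covForm_transition he he' hx hx' (S.flat k)
    have hvec := vecComp_transition he he' hx hx' k
    have hext := extForm_transition he he' hx hx' (w := S.flat k)
      (by rw [hτ]; exact differentiableAt_covForm hd)
    rw [hτ] at hcov hvec
    obtain ⟨v, hv⟩ : ∃ v, covForm e' (S.flat k) (e' p) v ≠ 0 := by
      by_contra! hcon
      refine flat_ne_zero (S := S) hk0 ?_
      have hb := (mdifferentiable_of_mem_maximalAtlas he').symm.mfderiv_bijective hx
      have h3 : S.flat k (e'.symm (e' p)) = 0 := by
        ext u
        obtain ⟨a, rfl⟩ := hb.2 u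
        exact hcon a
      rwa [hsymm] at h3
    have h3 := h2 v
    rw [hext, hτ, ← hvec, h1] at h3
    rw [hcov] at h3 hv
    exact mul_right_cancel₀ hv h3
  -- The value at `p` is taken in the preferred chart at `p`, which may jump with `p`; continuity
  -- follows since `key` identifies this function with the factor of the fixed chart `e`.
  refine ⟨fun p => f _ (hchart p) (chartAt E4 p p), fun e he => ⟨?_, fun x hx hxW hxT => ?_⟩⟩
  · have h1 : ContinuousOn (fun p => f e he (e p)) {p | p ∈ e.source ∧ p ∈ W ∧ T p ≠ 0} := by
      refine (hfc e he).comp (e.continuousOn.mono fun p hp => hp.1) fun p hp => ?_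
      exact ⟨e.map_source hp.1, by
        rw [mem_preimage, e.left_inv hp.1]; exact ⟨hp.2.1, (h.ne_zero hp.2.1 hp.2.2).1⟩⟩
    exact h1.congr fun p hp => key _ _ _ _ p (mem_chart_source E4 p) hp.1 hp.2.1 hp.2.2
  · obtain ⟨-, -, h1, h2⟩ := hf e he x ⟨hx, hxW, (h.ne_zero hxW hxT).1⟩
    refine ⟨h1, fun β => ?_⟩
    have h3 := key e he _ (hchart (e.symm x)) _ (e.map_target hx) (mem_chart_source E4 _) hxW hxT
    rw [e.right_inv hx] at h3
    rw [h2 β, h3]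

end WeylSpace

end

/-! ### Streamlines are null geodesics. -/

section

open IsManifold Topology Set

section Curve

variable {M : Type*} [TopologicalSpace M] [ChartedSpace E4 M] [IsManifold (𝓡 4) ∞ M]
  {e : OpenPartialHomeomorph M E4} {k : VecField M} {c : ℝ → M} {I : Set ℝ}

lemma IsMIntegralCurveOn.hasDerivAt_chart (hI : IsOpen I)
    (hc : IsMIntegralCurveOn (I := 𝓡 4) c k I) (he : e ∈ maximalAtlas (𝓡 4) ∞ M) {t : ℝ}
    (ht : t ∈ I) (hct : c t ∈ e.source) :
    HasDerivAt (fun s => e (c s)) (vecComp e k (e (c t))) t := by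
  have h1 := (hc t ht).hasMFDerivAt (hI.mem_nhds ht)
  have h2 := ((mdifferentiable_of_mem_maximalAtlas he).mdifferentiableAt hct).hasMFDerivAt
  let A : E4 →L[ℝ] E4 := mfderiv (𝓡 4) (𝓡 4) e (c t)
  let v : E4 := k (c t)
  have h3 : HasFDerivAt (fun s => e (c s)) (A.comp ((1 : ℝ →L[ℝ] ℝ).smulRight v)) t :=
    (h2.comp t h1).hasFDerivAt
  have h4 := h3.hasDerivAt
  rw [vecComp_apply k hct]
  exact (by simpa using h4 : HasDerivAt (fun s => e (c s)) (A v) t)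

omit [IsManifold (𝓡 4) ∞ M] in
lemma coord_fderiv (X : E4 → E4) {x : E4} (hX : DifferentiableAt ℝ X x) (v : E4) (β : Fin 4) :
    fderiv ℝ X x v β = ∑ α, v α * Coord.pd α (fun y => X y β) x := by
  have h : ∀ α, Coord.pd α (fun y => X y β) x
      = fderiv ℝ X x (EuclideanSpace.single α 1) β := fun α => by
    have h2 : HasFDerivAt (fun y => X y β) ((EuclideanSpace.proj β : E4 →L[ℝ] ℝ).comp
        (fderiv ℝ X x)) x := (EuclideanSpace.proj β : E4 →L[ℝ] ℝ).hasFDerivAt.comp x hX.hasFDerivAt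
    rw [Coord.pd, h2.fderiv]
    simp
  conv_lhs => rw [← sum_smul_single v]
  rw [map_sum]
  simp [h]

end Curve

namespace WeylSpace

variable {M : Type*} [TopologicalSpace M] [ChartedSpace E4 M] [IsManifold (𝓡 4) ∞ M]
  {S : WeylSpace M} {T : BilinField M}

/-- Along an integral curve the acceleration factor is a single continuous function of the
parameter, so one reparametrization makes the whole curve affine at once, in every chart. It remains
to check regularity and to apply the chain rule. -/
lemma movesOnNullGeodesics (htr : S.Traceless T) (hcons : S.Conserved T) :
    S.MovesOnNullGeodesics T := by
  intro W ρ k h I c hI hI' hc hcT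
  obtain ⟨F, hF⟩ := h.exists_acceleration htr hcons
  have hcc : ∀ t ∈ I, ContinuousAt c t := fun t ht =>
    ((hc t ht).hasMFDerivAt (hI.mem_nhds ht)).continuousAt
  have hFc : ContinuousOn (fun t => F (c t)) I := fun t ht => by
    have h1 := (hF _ (chart_mem_maximalAtlas (c t))).1 (c t)
      ⟨mem_chart_source E4 (c t), hcT t ht⟩
    refine Filter.Tendsto.comp h1 (tendsto_nhdsWithin_iff.mpr
      ⟨(hcc t ht).continuousWithinAt, ?_⟩)
    filter_upwards [self_mem_nhdsWithin, mem_nhdsWithin_of_mem_nhds ((hcc t ht).eventually_mem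
      ((chartAt E4 (c t)).open_source.mem_nhds (mem_chart_source E4 _)))] with s hs hs'
    exact ⟨hs', hcT s hs⟩
  obtain ⟨J, σ, q, hJ, hJ', hbij, hqpos, hσ, hq⟩ := exists_affine_parameter hI hI' hFc
  have hσc : ContinuousOn σ J := fun s hs => (hσ s hs).continuousAt.continuousWithinAt
  have hqc : ContinuousOn q J := fun s hs => (hq s hs).continuousAt.continuousWithinAt
  have hq1 : ContDiffOn ℝ 1 q J := by
    refine contDiffOn_succ_of_hasDerivAt (n := 0) hJ hq ?_
    refine contDiffOn_zero.mpr (ContinuousOn.mul ?_ (hqc.pow 2))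
    exact (hFc.comp hσc hbij.mapsTo).neg
  have hσ2 : ContDiffOn ℝ 2 σ J := contDiffOn_succ_of_hasDerivAt (n := 1) hJ hσ hq1
  have hcσ : ∀ s ∈ J, ContinuousAt (c ∘ σ) s := fun s hs =>
    ContinuousAt.comp (hcc _ (hbij.mapsTo hs)) (hσ s hs).continuousAt
  -- the velocity in a chart
  have hvel : ∀ e ∈ maximalAtlas (𝓡 4) ∞ M, ∀ s ∈ J, c (σ s) ∈ e.source →
      HasDerivAt (fun s => e ((c ∘ σ) s)) (q s • vecComp e k (e (c (σ s)))) s :=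
    fun e he s hs hse => (hc.hasDerivAt_chart hI he (hbij.mapsTo hs) hse).scomp s (hσ s hs)
  have hopen : ∀ e : OpenPartialHomeomorph M E4, IsOpen {s | s ∈ J ∧ (c ∘ σ) s ∈ e.source} :=
    fun e => ContinuousOn.isOpen_inter_preimage
      (fun s hs => (hcσ s hs).continuousWithinAt) hJ e.open_source
  have hKo : ∀ e : OpenPartialHomeomorph M E4, IsOpen (e.target ∩ e.symm ⁻¹' W) := fun e =>
    e.isOpen_inter_preimage_symm h.isOpen
  have hmem : ∀ (e : OpenPartialHomeomorph M E4) s, s ∈ J → c (σ s) ∈ e.source →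
      e (c (σ s)) ∈ e.target ∩ e.symm ⁻¹' W := fun e s hs hse => ⟨e.map_source hse, by
    rw [mem_preimage, e.left_inv hse]; exact (hcT _ (hbij.mapsTo hs)).1⟩
  have hk0 : ∀ e ∈ maximalAtlas (𝓡 4) ∞ M, ∀ s ∈ J, c (σ s) ∈ e.source →
      vecComp e k (e (c (σ s))) ≠ 0 := fun e he s hs hse h0 => by
    have hs' := hcT _ (hbij.mapsTo hs)
    have h1 := mfderiv_symm_vecComp he k (e.map_source hse)
    rw [h0, e.left_inv hse] at h1
    exact (h.ne_zero hs'.1 hs'.2).2 (h1.symm.trans (map_zero _))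
  refine ⟨J, σ, hJ, hJ', hbij, hσ2, fun s hs => (hσ s hs).deriv ▸ hqpos s hs, ?_, ?_, ?_, ?_⟩
  · intro s hs
    refine ContMDiffAt.contMDiffWithinAt ?_
    set e := chartAt E4 (c (σ s)) with he_def
    have he : e ∈ maximalAtlas (𝓡 4) ∞ M := chart_mem_maximalAtlas _
    have hse : c (σ s) ∈ e.source := mem_chart_source E4 _
    set N := {s | s ∈ J ∧ (c ∘ σ) s ∈ e.source} with hN
    have hNJ : N ⊆ J := fun _ hs => hs.1
    have hder : ∀ s ∈ N, HasDerivAt (fun s => e ((c ∘ σ) s)) (q s • vecComp e k (e (c (σ s)))) s :=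
      fun s hs => hvel e he s hs.1 hs.2
    -- Bootstrap: the velocity is `q` times the smooth field along the curve, hence as regular as
    -- the curve, up to the class C¹ of `q`. Two steps from continuity reach C².
    have hstep : ∀ n : ℕ, n ≤ 1 → ContDiffOn ℝ n (fun s => e ((c ∘ σ) s)) N →
        ContDiffOn ℝ (n + 1) (fun s => e ((c ∘ σ) s)) N := fun n hn h0 => by
      refine contDiffOn_succ_of_hasDerivAt (hopen e) hder ?_
      refine ((hq1.mono hNJ).of_le (by exact_mod_cast hn)).smul ?_
      exact ((h.smooth_k e he).of_le (by exact_mod_cast le_top)).comp h0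
        fun s hs => hmem e s hs.1 hs.2
    have h0 : ContDiffOn ℝ 0 (fun s => e ((c ∘ σ) s)) N := contDiffOn_zero.mpr
      fun s hs => (hder s hs).continuousAt.continuousWithinAt
    have h2 : ContDiffOn ℝ 2 (fun s => e ((c ∘ σ) s)) N := by
      have h1 := hstep 0 (by norm_num) h0
      have h2 := hstep 1 le_rfl (by simpa using h1)
      norm_num at h2
      exact h2
    have h3 : ContDiffAt ℝ 2 (fun s => e ((c ∘ σ) s)) s :=
      h2.contDiffAt ((hopen e).mem_nhds ⟨hs, hse⟩)
    have h4 : ContMDiffAt 𝓘(ℝ) (𝓡 4) 2 (fun s => e.symm (e ((c ∘ σ) s))) s :=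
      ((contMDiffAt_symm_of_mem_maximalAtlas he (e.map_source hse)).of_le
        (WithTop.coe_le_coe.2 (le_top : (2 : ℕ∞) ≤ ⊤))).comp s h3.contMDiffAt
    refine h4.congr_of_eventuallyEq ?_
    filter_upwards [(hopen e).mem_nhds ⟨hs, hse⟩] with s hs using (e.left_inv hs.2).symm
  · intro e he s hs (hse : c (σ s) ∈ e.source)
    rw [(hvel e he s hs hse).deriv]
    exact smul_ne_zero (hqpos s hs).ne' (hk0 e he s hs hse)
  · intro e he s hs (hse : c (σ s) ∈ e.source)
    rw [(hvel e he s hs hse).deriv]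
    have hs' := hcT _ (hbij.mapsTo hs)
    have h1 := ((hF e he).2 (e (c (σ s))) (e.map_source hse) (by rw [e.left_inv hse]; exact hs'.1)
      (by rw [e.left_inv hse]; exact hs'.2)).1
    simp only [PiLp.smul_apply, smul_eq_mul, Function.comp]
    calc _ = q s ^ 2 * ∑ μ, ∑ ν, bilinComp e S.g (e (c (σ s))) μ ν * vecComp e k (e (c (σ s))) μ
          * vecComp e k (e (c (σ s))) ν := by
          simp only [Finset.mul_sum]
          exact Finset.sum_congr rfl fun _ _ => Finset.sum_congr rfl fun _ _ => by ring
      _ = 0 := by rw [h1, mul_zero]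
  · intro e he s hs (hse : c (σ s) ∈ e.source) β
    have hs' := hcT _ (hbij.mapsTo hs)
    have h1 := ((hF e he).2 (e (c (σ s))) (e.map_source hse) (by rw [e.left_inv hse]; exact hs'.1)
      (by rw [e.left_inv hse]; exact hs'.2)).2 β
    rw [e.left_inv hse] at h1
    have hK : DifferentiableAt ℝ (vecComp e k) (e (c (σ s))) :=
      ((h.smooth_k e he).contDiffAt ((hKo e).mem_nhds (hmem e s hs hse))).differentiableAt (by simp)
    have h2 : deriv (fun s => e ((c ∘ σ) s)) =ᶠ[𝓝 s] fun s => q s • vecComp e k (e (c (σ s))) := by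
      filter_upwards [(hopen e).mem_nhds ⟨hs, hse⟩] with s hs using (hvel e he s hs.1 hs.2).deriv
    have hKc : HasDerivAt (fun s => vecComp e k (e (c (σ s))))
        (fderiv ℝ (vecComp e k) (e (c (σ s))) (q s • vecComp e k (e (c (σ s))))) s :=
      HasFDerivAt.comp_hasDerivAt (f := fun s => e (c (σ s))) s hK.hasFDerivAt
        (hvel e he s hs hse)
    have h3 : HasDerivAt (fun s => q s • vecComp e k (e (c (σ s)))) _ s :=
      (hq s hs).smul hKc
    rw [h2.deriv_eq, h3.deriv, (hvel e he s hs hse).deriv]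
    simp only [PiLp.add_apply, PiLp.smul_apply, smul_eq_mul, map_smul, coord_fderiv _ hK,
      Function.comp] at h1 ⊢
    set x := e (c (σ s))
    have h4 : ∑ α, ∑ γ, Coord.christoffel (bilinComp e S.g) β α γ x
        * (q s * vecComp e k x α) * (q s * vecComp e k x γ)
        = q s ^ 2 * ∑ α, ∑ γ, Coord.christoffel (bilinComp e S.g) β α γ x
          * vecComp e k x α * vecComp e k x γ := by
      simp only [Finset.mul_sum]
      exact Finset.sum_congr rfl fun _ _ => Finset.sum_congr rfl fun _ _ => by ring
    rw [h4]
    -- The acceleration of the reparametrized curve is q²∇_k k + q'k, and q' = -F q² cancels ∇_k k =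
    -- F k.
    linear_combination q s ^ 2 * h1

end WeylSpace

end

end

theorem lemma1 {M : Type*} [TopologicalSpace M] [ChartedSpace E4 M] [IsManifold (𝓡 4) ∞ M]
    (S : WeylSpace M) (om β lam : ℝ) (hβ : β ≠ 0)
    (φ : M → ℝ) (hφ : ContMDiff (𝓡 4) 𝓘(ℝ) ∞ φ) (hφ0 : ∀ p, φ p ≠ 0)
    (hProca : S.Proca om β φ) (hScalar : S.ScalarEq om lam φ) :
    S.DivergenceIdentity om β lam φ ∧
    ∀ T : BilinField M, S.EinsteinEq om β lam φ T →
      S.Traceless T ∧ S.Conserved T ∧ S.MovesOnNullGeodesics T := by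
  refine ⟨fun e he x hx => (S.calETotal_conserved hβ hφ hφ0 hProca hScalar he hx).1,
    fun T hT => ?_⟩
  have htr := S.traceless hβ hφ hφ0 hProca hScalar hT
  have hcons := S.conserved hβ hφ hφ0 hProca hScalar hT
  exact ⟨htr, hcons, WeylSpace.movesOnNullGeodesics htr hcons⟩
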